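/- Let $[n]=\{1,\dots,n\}$ and let $\log$ denote the logarithm to base $2$. For positive integers $n,m,t,\kappa$, a sample $\mathbf h\sim\mathcal H^{n,m,t,\kappa}$ is obtained as follows. Sample independent random functions $\mathbf h_1,\dots,\mathbf h_t:[m]\to[n]\cup\{0\}$ such that for every $i\in[t]$: $\Pr[\mathbf h_i(j)=0]=\frac12$ and $\Pr[\mathbf h_i(j)=v]=\frac1{2n}$ for all $j\in[m]$, $v\in[n]$, and the values of $\mathbf h_i$ at any at most $\kappa$ distinct inputs are mutually independent (any laws with these properties are allowed). Then, for $j\in[m]$, put $\mathbf h(j)=\mathbf h_q(j)$ for the smallest $q\le t$ with $\mathbf h_q(j)\neq0$, and $\mathbf h(j)=-1$ if there is no such $q$. For an array $a\in[m]^n$ and $h:[m]\to[n]\cup\{-1\}$, let $G_{a,h}$ be the digraph on $[n]$ with an edge $(x,h(a_x))$ for each $x$ with $h(a_x)\ne-1$, let $\mathsf{Out}_{a,h}(x)$ be the set of vertices reachable from $x$ in $G_{a,h}$ (including $x$ itself), and let $F_2(a)=\#\{(i,j)\in[n]^2: a_i=a_j\}$. There are absolute constants $c,C>0$ such that the following holds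 for all positive integers $n,m$ and every $a\in[m]^n$. Let $\kappa$ be $20\log n$ rounded down or up to an integer, and let $\mathbf x$ be uniform on $[n]$ and independent of $\mathbf h_1,\dots,\mathbf h_t$. 1. If $t\ge1$ is $\frac12\log n$ rounded down or up to an integer, and $\mathbf h\sim\mathcal H^{n,m,t,\kappa}$, then for all $u\ne v$ in $[n]$, $$\Pr_{\mathbf h,\mathbf x}\big[u,v\in\mathsf{Out}_{a,\mathbf h}(\mathbf x)\big]\ \ge\ \frac{c}{F_2(a)}.$$ 2. If $t\le\lceil\frac12\log n\rceil$ and $\mathbf h\sim\mathcal H^{n,m,t,\kappa}$, then for every $u\in[n]$, $$\Pr_{\mathbf h,\mathbf x}\big[u\in\mathsf{Out}_{a,\mathbf h}(\mathbf x)\big]\ \le\ C\cdot\frac{2^t}{n}.$$ -/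

import Mathlib

open MeasureTheory ProbabilityTheory

/-- `k` is the real number `r ≥ 0` rounded down or rounded up to an integer. -/
def IsRounding (k : ℕ) (r : ℝ) : Prop :=
  k = ⌊r⌋₊ ∨ k = ⌈r⌉₊

/-- The second frequency moment of the array `a`: the number of ordered pairs `(i, j)`
with `a i = a j`. -/
def secondMoment {n m : ℕ} (a : Fin n → Fin m) : ℕ :=
  ∑ i, ∑ j, if a i = a j then 1 else 0

/-- `D` is the law of a building-block hash function `[m] → [n] ∪ {0}`. The codomain is
`Fin (n + 1)`, where `0` is the extra symbol and `v.succ` stands for the vertex `v : Fin n`.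
Every entry is `0` with probability `1/2` and equals any given vertex with probability `1/(2n)`,
and the entries at any at most `κ` distinct inputs are mutually independent. -/
structure IsBuildingHash (n m κ : ℕ) (D : Measure (Fin m → Fin (n + 1))) : Prop where
  isProbabilityMeasure : IsProbabilityMeasure D
  prob_zero : ∀ j : Fin m, D.real {g | g j = 0} = 1 / 2
  prob_vertex : ∀ (j : Fin m) (v : Fin n), D.real {g | g j = v.succ} = 1 / (2 * (n : ℝ))
  indep : ∀ J : Finset (Fin m), J.card ≤ κ →
    iIndepFun (fun (j : J) (g : Fin m → Fin (n + 1)) => g j) D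

/-- The final hash `[m] → [n] ∪ {-1}` obtained from `h₁, …, h_t`: the value at `j` is `h_q(j)` for
the smallest `q` with `h_q(j) ≠ 0`, and it is `none` (that is, `-1`) if there is no such `q`. -/
def finalHash {n m t : ℕ} (h : Fin t → Fin m → Fin (n + 1)) (j : Fin m) : Option (Fin n) :=
  if hq : ∃ q, h q j ≠ 0 then some ((h (Fin.find _ hq) j).pred (Fin.find_spec hq)) else none

/-- The digraph `G_{a,h}` on `[n]`, with an edge from `x` to `h(a_x)` whenever `h(a_x) ≠ -1`. -/
def walkGraph {n m : ℕ} (a : Fin n → Fin m) (h : Fin m → Option (Fin n)) : Digraph (Fin n) where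
  Adj x y := h (a x) = some y

/-- The set of vertices reachable from `x` in `G_{a,h}` (by paths of length `≥ 0`). -/
def outSet {n m : ℕ} (a : Fin n → Fin m) (h : Fin m → Option (Fin n)) (x : Fin n) :
    Set (Fin n) :=
  {u | Relation.ReflTransGen (walkGraph a h).Adj x u}

/-- The joint law of `(h₁, …, h_t)` and `x`: the `h_i` are independent with laws `D i`, and `x` is
uniform on `[n]` and independent of them. -/
noncomputable def sampleLaw {n m t : ℕ} (D : Fin t → Measure (Fin m → Fin (n + 1))) :
    Measure ((Fin t → Fin m → Fin (n + 1)) × Fin n) :=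
  (Measure.pi D).prod (uniformOn Set.univ)

/-! The levels are revealed one at a time. The walk from `z` through the first `q` levels, if it
stops, does so at a vertex whose array value is the label of `z` (`levelLabel`), and the next level
acts on labels just as the first acts on array values. One-level estimates can therefore be
iterated, `sum_prod_mul_eq_resample` isolating the current level. Inside a level, a walk through new
labels sees fresh values: each of the `n` candidate predecessors of a vertex points to it with
probability `1 / (2 n)`, so the number of backward walks halves with each step, and about `1 + 1/2 +
1/4 + ⋯ = 2` vertices lead to a given one.

Upper bound: the set of vertices from which `u` is reached grows in expectation by a factor of at
most `2 + 2 / n` per level (`sum_card_nextReachSet_le`), and `(1 + 1 / n) ^ t ≤ 3`.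

Lower bound: count pairs `(x, x')` such that `x` reaches `u` and `x'` reaches `v`. Their number is
multiplied by about `4` per level, with relative error of order `√F / n`, where `F` counts pairs of
vertices with equal labels. In turn `√F` at most doubles per level, up to lower order
(`sum_mul_sqrt_collisionCount_nextLabel_le`). The two quantities are correlated, so
`four_mul_potential_le` follows them together through the weight of pairs times `1 - A √F / n`. The
iteration stops at a level `r` where `2 ^ r √F₂` is a small constant times `n`. One more level sends
`u` to a given `x'` with probability `1 / (2 n)`, which yields `x → u → x' → v`
(`le_sum_card_linked`). With `x` uniform this has probability at least `4 ^ r / (4 n ^ 2)`, of order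
`1 / F₂`.

Limited independence suffices because walks are cut after `K` steps with `n ≤ 2 ^ K`, and each
one-level estimate reveals at most `4 K` inputs. -/

/-! ### Hash laws as weights with fresh inputs -/

/-- A nonnegative weight `ν` on hash functions for which prescribing nonzero values at `k ≤ N`
distinct inputs outside `Q` always selects total weight `w * (1 / (2 n)) ^ k`. -/
def IsFreshWeight {n m : ℕ} (ν : (Fin m → Fin (n + 1)) → ℝ) (Q : Finset (Option (Fin m)))
    (N : ℕ) (w : ℝ) : Prop :=
  (∀ g, 0 ≤ ν g) ∧ ∀ L : List (Fin m × Fin n), (L.map Prod.fst).Nodup →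
    (∀ e ∈ L, some e.1 ∉ Q) → L.length ≤ N →
    ∑ g, (if ∀ e ∈ L, g e.1 = e.2.succ then ν g else 0) = w * (1 / (2 * n)) ^ L.length

/-- The restriction of the weight `ν` to the hash functions with value `v` at `j`. -/
def condWeight {n m : ℕ} (ν : (Fin m → Fin (n + 1)) → ℝ) (j : Fin m) (v : Fin n)
    (g : Fin m → Fin (n + 1)) : ℝ :=
  if g j = v.succ then ν g else 0

lemma measureReal_eq_sum_ite {α : Type*} [Fintype α] [MeasurableSpace α]
    [MeasurableSingletonClass α] (μ : Measure α) [IsFiniteMeasure μ] (P : α → Prop)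
    [DecidablePred P] :
    μ.real {x | P x} = ∑ x, if P x then μ.real {x} else 0 := by
  rw [← Finset.sum_filter]
  have := sum_measureReal_singleton (μ := μ) (Finset.univ.filter P)
  rw [this]
  congr 1
  ext x; simp

/-- The only place where limited independence enters: all later estimates within a level multiply
probabilities of nonzero values at distinct inputs. -/
lemma IsBuildingHash.isFreshWeight {n m κ : ℕ} {D : Measure (Fin m → Fin (n + 1))}
    (hD : IsBuildingHash n m κ D) : IsFreshWeight (fun g => D.real {g}) ∅ κ 1 := by
  classical
  have := hD.isProbabilityMeasure
  refine ⟨fun g => measureReal_nonneg, fun L hL _ hlen => ?_⟩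
  rw [← measureReal_eq_sum_ite D, one_mul]
  set J : Finset (Fin m) := (L.map Prod.fst).toFinset with hJ
  have hcard : J.card = L.length := by
    rw [hJ, List.toFinset_card_of_nodup hL, List.length_map]
  let s : J → Set (Fin (n + 1)) := fun j => {y | ∀ e ∈ L, e.1 = j → y = e.2.succ}
  have hset : {g : Fin m → Fin (n + 1) | ∀ e ∈ L, g e.1 = e.2.succ} =
      ⋂ j ∈ (Finset.univ : Finset J), (fun g : Fin m → Fin (n + 1) => g j) ⁻¹' (s j) := by
    ext g
    simp only [Set.mem_ofPred_eq, Finset.mem_univ, Set.iInter_true, Set.mem_iInter,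
      Set.mem_preimage, s]
    constructor
    · rintro h j e he hej
      rw [← hej]; exact h e he
    · intro h e he
      exact h ⟨e.1, by rw [hJ, List.mem_toFinset]; exact List.mem_map_of_mem he⟩ e he rfl
  rw [hset, measureReal_def, (hD.indep J (hcard.trans_le hlen)).measure_inter_preimage_eq_mul
    Finset.univ (fun j _ => MeasurableSet.of_discrete), ENNReal.toReal_prod]
  have hone : ∀ j : J, (D ((fun g : Fin m → Fin (n + 1) => g j) ⁻¹' (s j))).toReal
      = 1 / (2 * n) := by
    rintro ⟨j, hj⟩
    rw [hJ, List.mem_toFinset, List.mem_map] at hj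
    obtain ⟨e, he, rfl⟩ := hj
    rw [← hD.prob_vertex e.1 e.2, measureReal_def]
    congr 2
    ext g
    simp only [Set.mem_preimage, Set.mem_ofPred_eq, s]
    constructor
    · intro h; exact h e he rfl
    · intro h e' he' hee
      rw [h, List.inj_on_of_nodup_map hL he' he hee]
  rw [Finset.prod_congr rfl (fun j _ => hone j), Finset.prod_const, Finset.card_univ,
    Fintype.card_coe, hcard]

namespace IsFreshWeight

variable {n m N : ℕ} {ν : (Fin m → Fin (n + 1)) → ℝ} {Q : Finset (Option (Fin m))} {w : ℝ}

lemma nonneg (h : IsFreshWeight ν Q N w) (g : Fin m → Fin (n + 1)) : 0 ≤ ν g := h.1 g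

lemma sum_eq (h : IsFreshWeight ν Q N w) : ∑ g, ν g = w := by
  simpa using h.2 [] (by simp) (by simp) (by simp)

lemma weight_nonneg (h : IsFreshWeight ν Q N w) : 0 ≤ w := by
  rw [← h.sum_eq]; exact Finset.sum_nonneg fun g _ => h.nonneg g

lemma mono (h : IsFreshWeight ν Q N w) {Q' : Finset (Option (Fin m))} {N' : ℕ} (hQ : Q ⊆ Q')
    (hN : N' ≤ N) : IsFreshWeight ν Q' N' w :=
  ⟨h.1, fun L h1 h2 h3 => h.2 L h1 (fun e he hq => h2 e he (hQ hq)) (h3.trans hN)⟩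

/-- Revealing a fresh input spends one unit of the budget `N` and a factor `1 / (2 n)` of the mass.
Leaving the restriction unnormalised avoids conditional measures. -/
lemma cond (h : IsFreshWeight ν Q (N + 1) w) {j : Fin m} (hj : some j ∉ Q) (v : Fin n) :
    IsFreshWeight (condWeight ν j v) (insert (some j) Q) N (w / (2 * n)) := by
  refine ⟨fun g => ?_, fun L h1 h2 h3 => ?_⟩
  · unfold condWeight; split_ifs
    · exact h.nonneg g
    · exact le_rfl
  · have key := h.2 ((j, v) :: L) ?_ ?_ (by simpa using h3)
    · rw [List.length_cons, pow_succ] at key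
      rw [show w / (2 * (n : ℝ)) * (1 / (2 * n)) ^ L.length
        = w * ((1 / (2 * n)) ^ L.length * (1 / (2 * n))) by ring, ← key]
      refine Finset.sum_congr rfl fun g _ => ?_
      simp only [condWeight, List.forall_mem_cons]
      by_cases h' : g j = v.succ <;> simp [h']
    · simp only [List.map_cons, List.nodup_cons]
      refine ⟨fun hm => ?_, h1⟩
      obtain ⟨e, he, hej⟩ := List.mem_map.1 hm
      exact h2 e he (by simp [hej])
    · intro e he
      rcases List.mem_cons.1 he with rfl | he
      · exact hj
      · exact fun hq => h2 e he (Finset.mem_insert_of_mem hq)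

lemma sum_value (h : IsFreshWeight ν Q (N + 1) w) {j : Fin m} (hj : some j ∉ Q) (v : Fin n) :
    ∑ g, (if g j = v.succ then ν g else 0) = w / (2 * n) :=
  (h.cond hj v).sum_eq

end IsFreshWeight

/-! ### Label classes and collisions -/

section Labels

variable {n m : ℕ}

/-- The number of vertices with label `o`. -/
def classCount (b : Fin n → Option (Fin m)) (o : Option (Fin m)) : ℝ :=
  ∑ y, if b y = o then 1 else 0

/-- The number of vertices whose label lies in `Q`. -/
def labelMass (b : Fin n → Option (Fin m)) (Q : Finset (Option (Fin m))) : ℝ :=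
  ∑ y, if b y ∈ Q then 1 else 0

/-- The number of ordered pairs of vertices with the same label, `none` included. -/
def collisionCount (b : Fin n → Option (Fin m)) : ℝ :=
  ∑ y, classCount b (b y)

variable (b : Fin n → Option (Fin m))

lemma classCount_nonneg (o : Option (Fin m)) : 0 ≤ classCount b o :=
  Finset.sum_nonneg fun y _ => by split_ifs <;> norm_num

lemma labelMass_nonneg (Q : Finset (Option (Fin m))) : 0 ≤ labelMass b Q :=
  Finset.sum_nonneg fun y _ => by split_ifs <;> norm_num

lemma collisionCount_nonneg : 0 ≤ collisionCount b :=
  Finset.sum_nonneg fun _ _ => classCount_nonneg b _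

@[simp] lemma labelMass_empty : labelMass b ∅ = 0 := by simp [labelMass]

lemma labelMass_insert_le (o : Option (Fin m)) (Q : Finset (Option (Fin m))) :
    labelMass b (insert o Q) ≤ labelMass b Q + classCount b o := by
  unfold labelMass classCount
  rw [← Finset.sum_add_distrib]
  refine Finset.sum_le_sum fun y _ => ?_
  by_cases h1 : b y = o <;> by_cases h2 : b y ∈ Q <;> simp [h1, h2] <;> split_ifs <;> norm_num

lemma classCount_sq_le (o : Option (Fin m)) : classCount b o ^ 2 ≤ collisionCount b := by
  rw [sq]
  nth_rewrite 1 [classCount]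
  rw [Finset.sum_mul]
  refine Finset.sum_le_sum fun y _ => ?_
  split_ifs with h
  · rw [h, one_mul]
  · rw [zero_mul]; exact classCount_nonneg b _

lemma classCount_le_sqrt (o : Option (Fin m)) : classCount b o ≤ √(collisionCount b) :=
  Real.le_sqrt_of_sq_le (classCount_sq_le b o)

lemma one_le_classCount (y : Fin n) : 1 ≤ classCount b (b y) := by
  have := Finset.single_le_sum (f := fun z => if b z = b y then (1 : ℝ) else 0)
    (fun z _ => by split_ifs <;> norm_num) (Finset.mem_univ y)
  simpa [classCount] using this

lemma card_le_collisionCount : (n : ℝ) ≤ collisionCount b := by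
  have := Finset.sum_le_sum fun (y : Fin n) (_ : y ∈ Finset.univ) => one_le_classCount b y
  simpa [collisionCount] using this

lemma classCount_le_card (o : Option (Fin m)) : classCount b o ≤ n := by
  have : classCount b o ≤ ∑ _y : Fin n, (1 : ℝ) :=
    Finset.sum_le_sum fun y _ => by split_ifs <;> norm_num
  simpa using this

lemma collisionCount_le_sq : collisionCount b ≤ (n : ℝ) ^ 2 := by
  have : collisionCount b ≤ ∑ _y : Fin n, (n : ℝ) :=
    Finset.sum_le_sum fun y _ => classCount_le_card b _
  simpa [sq] using this

end Labels

/-! ### Forward exploration through new labels -/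

section Explore

variable {n m : ℕ}

/-- Starting at `y`, the walk `z ↦ g (b z)` reaches a vertex where `halt` holds after fewer than
`K` steps, always leaving from labels that are new, that is, outside `Q` and not used before;
`halt` is given the set of labels known so far. If the walk survives for `K` steps, the answer
is `base`. -/
def exploreTo (b : Fin n → Option (Fin m)) (g : Fin m → Fin (n + 1))
    (halt : Finset (Option (Fin m)) → Fin n → Prop) (base : Prop) :
    ℕ → Finset (Option (Fin m)) → Fin n → Prop
  | 0, _, _ => base
  | K + 1, Q, y => halt Q y ∨ ∃ j v, b y = some j ∧ some j ∉ Q ∧ g j = Fin.succ v ∧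
      exploreTo b g halt base K (insert (some j) Q) v

variable {b : Fin n → Option (Fin m)} {N : ℕ} {Q : Finset (Option (Fin m))} {w : ℝ}

open Classical in
lemma sum_step_le {ν : (Fin m → Fin (n + 1)) → ℝ} (hν : ∀ g, 0 ≤ ν g) (y : Fin n)
    (P : Fin m → Fin n → (Fin m → Fin (n + 1)) → Prop) {B : ℝ} (hB : 0 ≤ B)
    (h : ∀ j, b y = some j → some j ∉ Q →
      ∑ v, ∑ g, (if P j v g then condWeight ν j v g else 0) ≤ B) :
    ∑ g, (if ∃ j v, b y = some j ∧ some j ∉ Q ∧ g j = Fin.succ v ∧ P j v g then ν g else 0)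
      ≤ B := by
  by_cases hy : ∃ j, b y = some j ∧ some j ∉ Q
  · obtain ⟨j, hj, hjQ⟩ := hy
    refine le_trans ?_ (h j hj hjQ)
    rw [Finset.sum_comm]
    refine Finset.sum_le_sum fun g _ => ?_
    have hnn : ∀ v, 0 ≤ (if P j v g then condWeight ν j v g else 0) := fun v => by
      unfold condWeight; split_ifs <;> first | exact hν g | exact le_rfl
    split_ifs with hex
    · obtain ⟨j', v, hj', -, hgv, hP⟩ := hex
      obtain rfl : j = j' := by rw [hj] at hj'; exact Option.some.inj hj'
      refine le_trans ?_ (Finset.single_le_sum (fun v _ => hnn v) (Finset.mem_univ v))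
      simp [hP, condWeight, hgv]
    · exact Finset.sum_nonneg fun v _ => hnn v
  · rw [Finset.sum_eq_zero]
    · exact hB
    · intro g _
      rw [if_neg]
      rintro ⟨j, v, h1, h2, -⟩
      exact hy ⟨j, h1, h2⟩

open Classical in
/-- The total weight of successful explorations, summed over the starting vertex `y`. The weight
`ν y` may depend on `y`. -/
theorem sum_exploreTo_le {ι : Type*} [Fintype ι] (hn : 0 < n)
    (halt : ι → (Fin m → Fin (n + 1)) → Finset (Option (Fin m)) → Fin n → Prop) (base : Prop)
    {α σ : ℝ} (hα : 0 ≤ α) (hσ : 0 ≤ σ)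
    (hhalt : ∀ (ν : Fin n → (Fin m → Fin (n + 1)) → ℝ) (Q : Finset (Option (Fin m))) (w : ℝ),
      (∀ y, IsFreshWeight (ν y) Q N w) →
      ∑ y, ∑ i, ∑ g, (if halt i g Q y then ν y g else 0) ≤ w * (α + σ * labelMass b Q))
    (K : ℕ) {ν : Fin n → (Fin m → Fin (n + 1)) → ℝ} (h : ∀ y, IsFreshWeight (ν y) Q (N + K) w) :
    ∑ y, ∑ i, ∑ g, (if exploreTo b g (halt i g) base K Q y then ν y g else 0) ≤
      w * (2 * α + 2 * σ * (labelMass b Q + collisionCount b / n)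
        + Fintype.card ι * n * (if base then 1 else 0) * (1 / 2) ^ K) := by
  have hn' : (0 : ℝ) < n := by exact_mod_cast hn
  induction K generalizing ν Q w with
  | zero =>
    have hw := (h ⟨0, hn⟩).weight_nonneg
    have hM := labelMass_nonneg b Q
    have hF := collisionCount_nonneg b
    simp only [exploreTo]
    by_cases hb : base
    · simp only [hb, if_true, fun y => (h y).sum_eq, Finset.sum_const, Finset.card_univ,
        Fintype.card_fin, nsmul_eq_mul, pow_zero, mul_one]
      have : 0 ≤ w * (2 * α + 2 * σ * (labelMass b Q + collisionCount b / n)) := by positivity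
      nlinarith
    · simp only [hb, if_false, Finset.sum_const_zero]
      positivity
  | succ K ih =>
    have hw := (h ⟨0, hn⟩).weight_nonneg
    set F := collisionCount b with hF
    have hF0 : 0 ≤ F := collisionCount_nonneg b
    set X : ℝ := Fintype.card ι * n * (if base then 1 else 0) * (1 / 2) ^ K with hX
    have hX0 : 0 ≤ X := by rw [hX]; split_ifs <;> positivity
    have hM := labelMass_nonneg b Q
    have hsplit : ∑ y, ∑ i, ∑ g,
          (if exploreTo b g (halt i g) base (K + 1) Q y then ν y g else 0) ≤
        ∑ y, ∑ i, ∑ g, (if halt i g Q y then ν y g else 0) +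
        ∑ y, ∑ i, ∑ g, (if ∃ j v, b y = some j ∧ some j ∉ Q ∧ g j = Fin.succ v ∧
          exploreTo b g (halt i g) base K (insert (some j) Q) v then ν y g else 0) := by
      simp only [← Finset.sum_add_distrib]
      refine Finset.sum_le_sum fun y _ => Finset.sum_le_sum fun i _ =>
        Finset.sum_le_sum fun g _ => ?_
      have h0 := (h y).nonneg g
      rw [exploreTo]
      split_ifs <;> simp_all
    refine hsplit.trans ?_
    have hrec : ∀ y, ∑ i, ∑ g, (if ∃ j v, b y = some j ∧ some j ∉ Q ∧ g j = Fin.succ v ∧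
          exploreTo b g (halt i g) base K (insert (some j) Q) v then ν y g else 0) ≤
        w / (2 * n) * (2 * α + 2 * σ * (labelMass b Q + classCount b (b y) + F / n) + X) := by
      intro y
      have hC := classCount_nonneg b (b y)
      by_cases hy : ∃ j, b y = some j ∧ some j ∉ Q
      · obtain ⟨j, hj, hjQ⟩ := hy
        have hstep : ∀ i, ∑ g, (if ∃ j v, b y = some j ∧ some j ∉ Q ∧ g j = Fin.succ v ∧
            exploreTo b g (halt i g) base K (insert (some j) Q) v then ν y g else 0) ≤
            ∑ v, ∑ g, (if exploreTo b g (halt i g) base K (insert (some j) Q) v then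
              condWeight (ν y) j v g else 0) := by
          intro i
          refine sum_step_le (h y).nonneg y
            (fun j v g => exploreTo b g (halt i g) base K (insert (some j) Q) v) ?_ ?_
          · refine Finset.sum_nonneg fun v _ => Finset.sum_nonneg fun g _ => ?_
            have := (h y).nonneg g
            unfold condWeight; split_ifs <;> simp_all
          · intro j' hj' _
            obtain rfl : j = j' := by rw [hj] at hj'; exact Option.some.inj hj'
            exact le_rfl
        refine (Finset.sum_le_sum fun i _ => hstep i).trans ?_
        rw [Finset.sum_comm]
        -- After the step to `v` the weight depends on `v`; this is why the induction allows one
        -- weight per starting vertex.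
        refine (ih (ν := fun v => condWeight (ν y) j v)
          (fun v => ((h y).cond (N := N + K) hjQ v))).trans ?_
        have hins := labelMass_insert_le b (some j) Q
        rw [← hj] at hins
        rw [← hj]
        gcongr
      · rw [Finset.sum_eq_zero]
        · positivity
        · intro i _
          refine Finset.sum_eq_zero fun g _ => ?_
          rw [if_neg]
          rintro ⟨j, v, h1, h2, -⟩
          exact hy ⟨j, h1, h2⟩
    -- Over all `y` the class counts average to `F / n`, and the total of the factors `w / (2 n)` is
    -- `w / 2`. Hence `α + (2 α) / 2 = 2 α`, and likewise for `σ`, so the bound reproduces itself.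
    refine (add_le_add (hhalt ν Q w fun y => (h y).mono (Finset.Subset.refl _) (by omega))
      (Finset.sum_le_sum fun y _ => hrec y)).trans (le_of_eq ?_)
    simp only [← Finset.mul_sum, Finset.sum_add_distrib, Finset.sum_const, Finset.card_univ,
      Fintype.card_fin, nsmul_eq_mul]
    rw [show ∑ y, classCount b (b y) = F from rfl]
    rw [show (Fintype.card ι : ℝ) * n * (if base then 1 else 0) * (1 / 2) ^ (K + 1) = X / 2 by
      rw [hX, pow_succ]; ring]
    field_simp
    ring

end Explore

/-! ### Where walks stop, and when two walks merge -/

section Walk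

variable {n m : ℕ}

/-- The walk `z ↦ g (b z)` from `z` stops at a vertex with label `j`, where `g j = 0`. -/
inductive EndsAt (b : Fin n → Option (Fin m)) (g : Fin m → Fin (n + 1)) : Fin n → Fin m → Prop
  | halt {z : Fin n} {j : Fin m} : b z = some j → g j = 0 → EndsAt b g z j
  | step {z v : Fin n} {j j' : Fin m} :
      b z = some j → g j = v.succ → EndsAt b g v j' → EndsAt b g z j'

variable {b : Fin n → Option (Fin m)} {g : Fin m → Fin (n + 1)}

lemma EndsAt.unique {z : Fin n} {j j' : Fin m} (h : EndsAt b g z j) (h' : EndsAt b g z j') :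
    j = j' := by
  induction h with
  | halt h1 h2 =>
    cases h' with
    | halt h3 h4 => rw [h1] at h3; exact Option.some.inj h3
    | step h3 h4 _ =>
      rw [h1] at h3
      obtain rfl := Option.some.inj h3
      rw [h2] at h4; exact absurd h4.symm (Fin.succ_ne_zero _)
  | step h1 h2 _ ih =>
    cases h' with
    | halt h3 h4 =>
      rw [h1] at h3
      obtain rfl := Option.some.inj h3
      rw [h2] at h4; exact absurd h4 (Fin.succ_ne_zero _)
    | step h3 h4 h5 =>
      rw [h1] at h3
      obtain rfl := Option.some.inj h3
      rw [h2] at h4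
      obtain rfl := Fin.succ_injective _ h4
      exact ih h5

variable (b g) in
open Classical in
/-- The label at which the walk `z ↦ g (b z)` from `z` stops, and `none` if it never stops or
meets the label `none`. -/
noncomputable def nextLabel (z : Fin n) : Option (Fin m) :=
  if h : ∃ j, EndsAt b g z j then some h.choose else none

lemma nextLabel_eq_some_iff {z : Fin n} {j : Fin m} :
    nextLabel b g z = some j ↔ EndsAt b g z j := by
  unfold nextLabel
  split_ifs with h
  · rw [Option.some_inj]
    exact ⟨fun e => e ▸ h.choose_spec, fun e => h.choose_spec.unique e⟩
  · exact ⟨fun e => by simp at e, fun e => absurd ⟨j, e⟩ h⟩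

lemma nextLabel_of_none {z : Fin n} (h : b z = none) : nextLabel b g z = none := by
  rw [Option.eq_none_iff_forall_ne_some]
  intro j hj
  rcases nextLabel_eq_some_iff.1 hj with ⟨h1, -⟩ | ⟨h1, -, -⟩ <;> simp [h] at h1

lemma nextLabel_of_zero {z : Fin n} {j : Fin m} (h : b z = some j) (h0 : g j = 0) :
    nextLabel b g z = some j :=
  nextLabel_eq_some_iff.2 (.halt h h0)

lemma nextLabel_of_succ {z v : Fin n} {j : Fin m} (h : b z = some j) (hv : g j = v.succ) :
    nextLabel b g z = nextLabel b g v := by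
  ext j'
  rw [nextLabel_eq_some_iff, nextLabel_eq_some_iff]
  refine ⟨fun e => ?_, fun e => .step h hv e⟩
  cases e with
  | halt h3 h4 =>
    rw [h] at h3
    obtain rfl := Option.some.inj h3
    rw [hv] at h4; exact absurd h4 (Fin.succ_ne_zero _)
  | step h3 h4 h5 =>
    rw [h] at h3
    obtain rfl := Option.some.inj h3
    rw [hv] at h4
    obtain rfl := Fin.succ_injective _ h4
    exact h5

lemma nextLabel_congr {z z' : Fin n} (h : b z = b z') : nextLabel b g z = nextLabel b g z' := by
  rcases hz : b z with _ | j
  · rw [nextLabel_of_none hz, nextLabel_of_none (h ▸ hz)]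
  · rcases Fin.eq_zero_or_eq_succ (g j) with h0 | ⟨v, hv⟩
    · rw [nextLabel_of_zero hz h0, nextLabel_of_zero (h ▸ hz) h0]
    · rw [nextLabel_of_succ hz hv, nextLabel_of_succ (h.symm.trans hz) hv]

variable (b g) in
/-- Within `K` steps, the walk from `y` meets a label of `Q` or repeats a label; or it is longer
than that. -/
def Touches : ℕ → Finset (Option (Fin m)) → Fin n → Prop :=
  exploreTo b g (fun Q y => b y ∈ Q) True

variable (b g) in
/-- The walk from `y` meets the label `o` in fewer than `K` steps, before it meets a label of `Q`
or repeats a label. -/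
def Hits (o : Option (Fin m)) : ℕ → Finset (Option (Fin m)) → Fin n → Prop :=
  exploreTo b g (fun _ y => b y = o) False

variable (b g) in
/-- The walk from `z` and the walk from `z'` meet at a common label, before either of them meets
a label of `Q` or repeats a label. -/
def Merges (K' : ℕ) (z' : Fin n) : ℕ → Finset (Option (Fin m)) → Fin n → Prop :=
  exploreTo b g (fun Q z => Hits b g (b z) K' Q z') False

lemma not_touches_succ {K : ℕ} {Q : Finset (Option (Fin m))} {y : Fin n}
    (h : ¬ Touches b g (K + 1) Q y) :
    b y ∉ Q ∧ ∀ j v, b y = some j → g j = Fin.succ v →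
      ¬ Touches b g K (insert (some j) Q) v := by
  simp only [Touches, exploreTo, not_or, not_exists, not_and] at h
  refine ⟨h.1, fun j v hj hv => h.2 j v hj (hj ▸ h.1) hv⟩

lemma hits_nextLabel_of_not_touches {K : ℕ} {Q : Finset (Option (Fin m))} {y : Fin n}
    (h : ¬ Touches b g K Q y) : Hits b g (nextLabel b g y) K Q y := by
  induction K generalizing Q y with
  | zero => exact absurd trivial h
  | succ K ih =>
    obtain ⟨h1, h2⟩ := not_touches_succ h
    rcases hy : b y with _ | j
    · exact Or.inl (hy.trans (nextLabel_of_none hy).symm)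
    · rcases Fin.eq_zero_or_eq_succ (g j) with h0 | ⟨v, hv⟩
      · exact Or.inl (hy.trans (nextLabel_of_zero hy h0).symm)
      · refine Or.inr ⟨j, v, hy, hy ▸ h1, hv, ?_⟩
        rw [nextLabel_of_succ hy hv]
        exact ih (h2 j v hy hv)

/-- Declaring a label known is harmless to a walk that never meets it. This transfers the labels of
one walk to the known set of another. -/
lemma not_touches_insert {K : ℕ} {Q : Finset (Option (Fin m))} {y : Fin n} {o : Option (Fin m)}
    (h : ¬ Touches b g K Q y) (ho : ¬ Hits b g o K Q y) : ¬ Touches b g K (insert o Q) y := by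
  induction K generalizing Q y with
  | zero => exact absurd trivial h
  | succ K ih =>
    obtain ⟨h1, h2⟩ := not_touches_succ h
    rintro (hc | ⟨j, v, hj, -, hv, hc⟩)
    · rcases Finset.mem_insert.1 hc with hc | hc
      · exact ho (Or.inl hc)
      · exact h1 hc
    · rw [Finset.insert_comm] at hc
      exact ih (h2 j v hj hv) (fun hh => ho (Or.inr ⟨j, v, hj, hj ▸ h1, hv, hh⟩)) hc

lemma touches_of_hits {K : ℕ} {Q : Finset (Option (Fin m))} {y : Fin n} {o : Option (Fin m)}
    (ho : o ∈ Q) (h : Hits b g o K Q y) : Touches b g K Q y := by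
  induction K generalizing Q y with
  | zero => exact trivial
  | succ K ih =>
    rcases h with h | ⟨j, v, hj, hjQ, hv, hc⟩
    · exact Or.inl (show b y ∈ Q from h.symm ▸ ho)
    · exact Or.inr ⟨j, v, hj, hjQ, hv, ih (Finset.mem_insert_of_mem ho) hc⟩

lemma touches_of_nextLabel_eq_none {K : ℕ} {Q : Finset (Option (Fin m))} {y : Fin n}
    (hQ : none ∈ Q) (h : nextLabel b g y = none) : Touches b g K Q y := by
  by_contra hc
  exact hc (touches_of_hits hQ (h ▸ hits_nextLabel_of_not_touches hc))

/-- Follow the walk from `z` to its first label that lies on the walk from `z'`; the common final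
label shows that there is one. The labels passed before it are missed by the other walk, so both
walks remain fresh. -/
lemma merges_of_nextLabel_eq {K K' : ℕ} {Q : Finset (Option (Fin m))} {z z' : Fin n}
    (h : ¬ Touches b g K Q z) (h' : ¬ Touches b g K' Q z')
    (he : nextLabel b g z = nextLabel b g z') : Merges b g K' z' K Q z := by
  induction K generalizing Q z with
  | zero => exact absurd trivial h
  | succ K ih =>
    obtain ⟨h1, h2⟩ := not_touches_succ h
    by_cases hh : Hits b g (b z) K' Q z'
    · exact Or.inl hh
    · have hl := hits_nextLabel_of_not_touches h'
      rw [← he] at hl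
      rcases hz : b z with _ | j
      · rw [nextLabel_of_none hz, ← hz] at hl
        exact absurd hl hh
      · rcases Fin.eq_zero_or_eq_succ (g j) with h0 | ⟨v, hv⟩
        · rw [nextLabel_of_zero hz h0, ← hz] at hl
          exact absurd hl hh
        · refine Or.inr ⟨j, v, hz, hz ▸ h1, hv, ih (h2 j v hz hv) ?_ ?_⟩
          · exact not_touches_insert h' (hz ▸ hh)
          · rw [← he, nextLabel_of_succ hz hv]

end Walk

/-! ### Expected numbers of touching, hitting and merging walks -/

section WalkSums

variable {n m : ℕ} {b : Fin n → Option (Fin m)} {N : ℕ} {Q : Finset (Option (Fin m))} {w : ℝ}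

open Classical in
lemma sum_touches_le (hn : 0 < n) (K : ℕ) {ν : Fin n → (Fin m → Fin (n + 1)) → ℝ}
    (h : ∀ y, IsFreshWeight (ν y) Q K w) :
    ∑ y, ∑ g, (if Touches b g K Q y then ν y g else 0) ≤
      w * (2 * labelMass b Q + 2 * (collisionCount b / n) + n * (1 / 2) ^ K) := by
  have := sum_exploreTo_le (b := b) (N := 0) (ι := Unit) hn (fun _ _ Q y => b y ∈ Q) True
    (α := 0) (σ := 1) le_rfl zero_le_one ?_ K (Q := Q) (w := w) (ν := ν) (by simpa using h)
  · simp only [Finset.univ_unique, Finset.sum_singleton, Fintype.card_unit] at this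
    refine this.trans (le_of_eq ?_)
    simp only [if_true]; push_cast; ring
  · intro ν Q w hν
    simp only [Finset.univ_unique, Finset.sum_singleton, zero_add, one_mul, labelMass,
      Finset.mul_sum]
    refine Finset.sum_le_sum fun y _ => ?_
    split_ifs
    · rw [(hν y).sum_eq, mul_one]
    · simp

open Classical in
lemma sum_hits_le (hn : 0 < n) (K : ℕ) (o : Option (Fin m))
    {ν : (Fin m → Fin (n + 1)) → ℝ} (h : IsFreshWeight ν Q K w) :
    ∑ y, ∑ g, (if Hits b g o K Q y then ν g else 0) ≤ w * (2 * classCount b o) := by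
  have := sum_exploreTo_le (b := b) (N := 0) (ι := Unit) hn (fun _ _ _ y => b y = o) False
    (α := classCount b o) (σ := 0) (classCount_nonneg b o) le_rfl ?_ K (Q := Q) (w := w)
    (ν := fun _ => ν) (fun _ => by simpa using h)
  · simp only [Finset.univ_unique, Finset.sum_singleton] at this
    refine this.trans (le_of_eq ?_)
    simp only [if_false]; ring
  · intro ν Q w hν
    simp only [Finset.univ_unique, Finset.sum_singleton, zero_mul, add_zero, classCount,
      Finset.mul_sum]
    refine Finset.sum_le_sum fun y _ => ?_
    split_ifs
    · rw [(hν y).sum_eq, mul_one]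
    · simp

open Classical in
-- Two nested explorations: the class of a vertex `z` is hit from at most `2 * classCount b (b z)`
-- starting points on average, `2 F` in total over `z`, and the outer exploration doubles this.
lemma sum_merges_le (hn : 0 < n) (K K' : ℕ) {ν : (Fin m → Fin (n + 1)) → ℝ}
    (h : IsFreshWeight ν Q (K' + K) w) :
    ∑ z, ∑ z', ∑ g, (if Merges b g K' z' K Q z then ν g else 0) ≤
      w * (4 * collisionCount b) := by
  have := sum_exploreTo_le (b := b) (N := K') (ι := Fin n) hn
    (fun z' g Q z => Hits b g (b z) K' Q z') False
    (α := 2 * collisionCount b) (σ := 0) (by have := collisionCount_nonneg b; positivity)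
    le_rfl ?_ K (Q := Q) (w := w) (ν := fun _ => ν) (fun _ => h)
  · refine this.trans (le_of_eq ?_)
    simp only [if_false]; ring
  · intro ν Q w hν
    simp only [zero_mul, add_zero, collisionCount, Finset.mul_sum]
    refine Finset.sum_le_sum fun y _ => ?_
    exact sum_hits_le hn K' (b y) (hν y)

open Classical in
/-- The walk from `y` reaches `R` through new labels, or lasts for `K` steps. -/
lemma sum_explore_mem_le (hn : 0 < n) (K : ℕ) (R : Finset (Fin n))
    {ν : (Fin m → Fin (n + 1)) → ℝ} (h : IsFreshWeight ν Q K w) :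
    ∑ y, ∑ g, (if exploreTo b g (fun _ y => y ∈ R) True K Q y then ν g else 0) ≤
      w * (2 * R.card + n * (1 / 2) ^ K) := by
  have := sum_exploreTo_le (b := b) (N := 0) (ι := Unit) hn (fun _ _ _ y => y ∈ R) True
    (α := R.card) (σ := 0) (by positivity) le_rfl ?_ K (Q := Q) (w := w)
    (ν := fun _ => ν) (fun _ => by simpa using h)
  · simpa [Finset.univ_unique, Finset.sum_singleton, Fintype.card_unit] using this
  · intro ν Q w hν
    simp only [Finset.univ_unique, Finset.sum_singleton, zero_mul, add_zero]
    rw [show w * (R.card : ℝ) = ∑ y, if y ∈ R then w else 0 by simp [mul_comm]]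
    refine Finset.sum_le_sum fun y _ => ?_
    split_ifs
    · rw [(hν y).sum_eq]
    · simp

end WalkSums

/-! ### Backward walks -/

section Backward

variable {n m : ℕ}

/-- The sum of `Ψ Q' y` over all `k`-step walks `y → ⋯ → z` under `x ↦ g (b x)` that leave from
distinct labels outside `Q` and `X`; here `Q'` is `Q` together with these labels. -/
def backSum (b : Fin n → Option (Fin m)) (g : Fin m → Fin (n + 1)) (X : Finset (Option (Fin m))) :
    ℕ → (Finset (Option (Fin m)) → Fin n → ℝ) → Finset (Option (Fin m)) → Fin n → ℝ
  | 0, Ψ, Q, z => Ψ Q z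
  | k + 1, Ψ, Q, z => ∑ y, if b y ∉ Q ∧ b y ∉ X ∧ ∃ j, b y = some j ∧ g j = z.succ then
      backSum b g X k Ψ (insert (b y) Q) y else 0

variable {b : Fin n → Option (Fin m)} {X : Finset (Option (Fin m))} {N : ℕ}

lemma backSum_sum (g : Fin m → Fin (n + 1)) {ι : Type*} (s : Finset ι)
    (Ψ : ι → Finset (Option (Fin m)) → Fin n → ℝ) (k : ℕ) (Q : Finset (Option (Fin m)))
    (z : Fin n) :
    backSum b g X k (fun Q y => ∑ i ∈ s, Ψ i Q y) Q z = ∑ i ∈ s, backSum b g X k (Ψ i) Q z := by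
  induction k generalizing Q z with
  | zero => rfl
  | succ k ih =>
    simp only [backSum]
    rw [Finset.sum_comm]
    refine Finset.sum_congr rfl fun y _ => ?_
    split_ifs
    · exact ih _ _
    · simp

lemma backSum_mul (g : Fin m → Fin (n + 1)) (c : ℝ)
    (Ψ : Finset (Option (Fin m)) → Fin n → ℝ) (k : ℕ) (Q : Finset (Option (Fin m)))
    (z : Fin n) :
    backSum b g X k (fun Q y => Ψ Q y * c) Q z = backSum b g X k Ψ Q z * c := by
  induction k generalizing Q z with
  | zero => rfl
  | succ k ih =>
    simp only [backSum, Finset.sum_mul]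
    refine Finset.sum_congr rfl fun y _ => ?_
    split_ifs
    · exact ih _ _
    · simp

lemma backSum_nonneg (g : Fin m → Fin (n + 1))
    {Ψ : Finset (Option (Fin m)) → Fin n → ℝ} (hΨ : ∀ Q y, 0 ≤ Ψ Q y) (k : ℕ)
    (Q : Finset (Option (Fin m))) (z : Fin n) : 0 ≤ backSum b g X k Ψ Q z := by
  induction k generalizing Q z with
  | zero => exact hΨ _ _
  | succ k ih =>
    refine Finset.sum_nonneg fun y _ => ?_
    split_ifs
    · exact ih _ _
    · exact le_rfl

lemma sum_mul_backSum_succ (ν : (Fin m → Fin (n + 1)) → ℝ)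
    (Θ : (Fin m → Fin (n + 1)) → Finset (Option (Fin m)) → Fin n → ℝ)
    (k : ℕ) (Q : Finset (Option (Fin m))) (z : Fin n) :
    ∑ g, ν g * backSum b g X (k + 1) (Θ g) Q z = ∑ y, ∑ g, ν g *
      (if b y ∉ Q ∧ b y ∉ X ∧ ∃ j, b y = some j ∧ g j = z.succ then
        backSum b g X k (Θ g) (insert (b y) Q) y else 0) := by
  simp only [backSum, Finset.mul_sum]
  rw [Finset.sum_comm]

lemma sum_mul_ite_eq_condWeight (ν : (Fin m → Fin (n + 1)) → ℝ)
    {f : (Fin m → Fin (n + 1)) → ℝ} {Q : Finset (Option (Fin m))} {y z : Fin n} {j : Fin m}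
    (hj : b y = some j) (hQ : b y ∉ Q) (hX : b y ∉ X) :
    ∑ g, ν g * (if b y ∉ Q ∧ b y ∉ X ∧ ∃ j, b y = some j ∧ g j = z.succ then f g else 0) =
      ∑ g, condWeight ν j z g * f g := by
  refine Finset.sum_congr rfl fun g _ => ?_
  have : (b y ∉ Q ∧ b y ∉ X ∧ ∃ j, b y = some j ∧ g j = z.succ) ↔ g j = z.succ := by
    constructor
    · rintro ⟨-, -, j', hj', hg⟩
      rw [hj] at hj'
      obtain rfl := Option.some.inj hj'
      exact hg
    · exact fun hg => ⟨hQ, hX, j, hj, hg⟩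
  simp only [this, condWeight]
  split_ifs <;> simp

/-- The `n` candidate predecessors have weight `1 / (2 n)` each, so a step back costs a factor `1 /
2`, and it enlarges the known label mass by `F / n` on average. `Θ` may depend on `g`, since inputs
not revealed by the walk are still fresh with budget `N`. -/
theorem sum_mul_backSum_le (hn : 0 < n) {α σ : ℝ} (hα : 0 ≤ α) (hσ : 0 ≤ σ)
    (Θ : (Fin m → Fin (n + 1)) → Finset (Option (Fin m)) → Fin n → ℝ)
    (hΘ : ∀ (ν : (Fin m → Fin (n + 1)) → ℝ) (Q : Finset (Option (Fin m))) (w : ℝ) (y : Fin n),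
      IsFreshWeight ν Q N w → Disjoint Q X →
      ∑ g, ν g * Θ g Q y ≤ w * (α + σ * labelMass b Q))
    (k : ℕ) {ν : (Fin m → Fin (n + 1)) → ℝ} {Q : Finset (Option (Fin m))} {w : ℝ} (z : Fin n)
    (h : IsFreshWeight ν Q (N + k) w) (hQ : Disjoint Q X) :
    ∑ g, ν g * backSum b g X k (Θ g) Q z ≤
      w * (1 / 2) ^ k * (α + σ * (labelMass b Q + k * (collisionCount b / n))) := by
  have hn' : (0 : ℝ) < n := by exact_mod_cast hn
  induction k generalizing ν Q w z with
  | zero => simpa [backSum] using hΘ ν Q w z h hQ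
  | succ k ih =>
    have hw := h.weight_nonneg
    set F := collisionCount b with hF
    have hF0 : 0 ≤ F := collisionCount_nonneg b
    have hM := labelMass_nonneg b Q
    rw [sum_mul_backSum_succ]
    have hy : ∀ y, ∑ g, ν g * (if b y ∉ Q ∧ b y ∉ X ∧ ∃ j, b y = some j ∧ g j = z.succ then
        backSum b g X k (Θ g) (insert (b y) Q) y else 0) ≤
        w / (2 * n) * (1 / 2) ^ k *
          (α + σ * (labelMass b Q + classCount b (b y) + k * (F / n))) := by
      intro y
      have hC := classCount_nonneg b (b y)
      by_cases hyc : ∃ j, b y = some j ∧ b y ∉ Q ∧ b y ∉ X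
      · obtain ⟨j, hj, hyQ, hyX⟩ := hyc
        rw [sum_mul_ite_eq_condWeight ν hj hyQ hyX]
        have hc := h.cond (N := N + k) (hj ▸ hyQ) z
        rw [← hj] at hc
        refine (ih y hc (Finset.disjoint_insert_left.2 ⟨hyX, hQ⟩)).trans ?_
        have := labelMass_insert_le b (b y) Q
        gcongr
      · rw [Finset.sum_eq_zero]
        · positivity
        · intro g _
          rw [if_neg, mul_zero]
          rintro ⟨h1, h2, j, hj, -⟩
          exact hyc ⟨j, hj, h1, h2⟩
    refine (Finset.sum_le_sum fun y _ => hy y).trans (le_of_eq ?_)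
    simp only [← Finset.mul_sum, Finset.sum_add_distrib, Finset.sum_const, Finset.card_univ,
      Fintype.card_fin, nsmul_eq_mul]
    rw [show ∑ y, classCount b (b y) = F from rfl]
    push_cast
    field_simp
    ring

/-- The same halving, less the predecessors whose label lies in `Q` or `X`; `β` caps what each of
them could have contributed. As `Q` grows along the walk, these losses add up to a term quadratic in
`k`. -/
theorem le_sum_mul_backSum (hn : 0 < n) {α σ β : ℝ} (hαβ : α ≤ β) (hσ : 0 ≤ σ) (hβ : 0 ≤ β)
    (hX : none ∈ X)
    (Θ : (Fin m → Fin (n + 1)) → Finset (Option (Fin m)) → Fin n → ℝ)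
    (hΘ : ∀ (ν : (Fin m → Fin (n + 1)) → ℝ) (Q : Finset (Option (Fin m))) (w : ℝ) (y : Fin n),
      IsFreshWeight ν Q N w → Disjoint Q X →
      w * (α - σ * labelMass b Q) ≤ ∑ g, ν g * Θ g Q y)
    (k : ℕ) {ν : (Fin m → Fin (n + 1)) → ℝ} {Q : Finset (Option (Fin m))} {w : ℝ} (z : Fin n)
    (h : IsFreshWeight ν Q (N + k) w) (hQ : Disjoint Q X) :
    w * (1 / 2) ^ k * (α - σ * labelMass b Q - k * σ * (collisionCount b / n)
        - β * (k * ((labelMass b Q + labelMass b X) / n) + k ^ 2 * (collisionCount b / n ^ 2))) ≤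
      ∑ g, ν g * backSum b g X k (Θ g) Q z := by
  have hn' : (0 : ℝ) < n := by exact_mod_cast hn
  induction k generalizing ν Q w z with
  | zero => simpa [backSum] using hΘ ν Q w z h hQ
  | succ k ih =>
    have hw := h.weight_nonneg
    set F := collisionCount b with hF
    have hF0 : 0 ≤ F := collisionCount_nonneg b
    have hM := labelMass_nonneg b Q
    have hM0 := labelMass_nonneg b X
    set M := labelMass b Q with hMdef
    set M0 := labelMass b X with hM0def
    rw [sum_mul_backSum_succ]
    set val : Fin n → ℝ := fun y => α - σ * (M + classCount b (b y)) - k * σ * (F / n)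
        - β * (k * ((M + classCount b (b y) + M0) / n) + k ^ 2 * (F / n ^ 2)) with hval
    have hy : ∀ y, w / (2 * n) * (1 / 2) ^ k * (val y - β * ((if b y ∈ Q then 1 else 0)
          + (if b y ∈ X then 1 else 0))) ≤
        ∑ g, ν g * (if b y ∉ Q ∧ b y ∉ X ∧ ∃ j, b y = some j ∧ g j = z.succ then
        backSum b g X k (Θ g) (insert (b y) Q) y else 0) := by
      intro y
      have hC := classCount_nonneg b (b y)
      by_cases hyc : b y ∉ Q ∧ b y ∉ X
      · obtain ⟨hyQ, hyX⟩ := hyc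
        obtain ⟨j, hj⟩ : ∃ j, b y = some j := by
          rw [← Option.ne_none_iff_exists']
          intro hnone; exact hyX (hnone ▸ hX)
        rw [sum_mul_ite_eq_condWeight ν hj hyQ hyX, if_neg hyQ, if_neg hyX, add_zero, mul_zero,
          sub_zero]
        have hc := h.cond (N := N + k) (hj ▸ hyQ) z
        rw [← hj] at hc
        refine le_trans ?_ (ih y hc (Finset.disjoint_insert_left.2 ⟨hyX, hQ⟩))
        have := labelMass_insert_le b (b y) Q
        rw [hval]
        dsimp only
        gcongr
      · have hval1 : val y ≤ β := by
          rw [hval]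
          have h1 : 0 ≤ σ * (M + classCount b (b y)) := by positivity
          have h2 : 0 ≤ k * σ * (F / n) := by positivity
          have h3 : 0 ≤ β * (k * ((M + classCount b (b y) + M0) / n) + k ^ 2 * (F / n ^ 2)) := by
            positivity
          dsimp only
          linarith
        have hone : (1 : ℝ) ≤ (if b y ∈ Q then 1 else 0) + (if b y ∈ X then 1 else 0) := by
          by_cases h1 : b y ∈ Q
          · rw [if_pos h1]; split_ifs <;> norm_num
          · have h2 : b y ∈ X := by tauto
            rw [if_neg h1, if_pos h2]; norm_num
        rw [Finset.sum_eq_zero]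
        · refine mul_nonpos_of_nonneg_of_nonpos (by positivity) ?_
          nlinarith
        · intro g _
          rw [if_neg, mul_zero]
          rintro ⟨h1, h2, -⟩
          exact hyc ⟨h1, h2⟩
    refine le_trans ?_ (Finset.sum_le_sum fun y _ => hy y)
    have hsum : ∑ y, (val y - β * ((if b y ∈ Q then 1 else 0) + (if b y ∈ X then 1 else 0))) =
        n * (α - σ * M - k * σ * (F / n) - β * (k * ((M + M0) / n) + k ^ 2 * (F / n ^ 2))
          - β * ((M + M0) / n)) - σ * F - β * (k * (F / n)) := by
      rw [hval]
      simp only [Finset.sum_sub_distrib, ← Finset.mul_sum, Finset.sum_add_distrib,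
        Finset.sum_const, Finset.card_univ, Fintype.card_fin, nsmul_eq_mul, ← Finset.sum_div]
      rw [show ∑ y, classCount b (b y) = F from rfl,
        show (∑ y, if b y ∈ Q then (1 : ℝ) else 0) = M from rfl,
        show (∑ y, if b y ∈ X then (1 : ℝ) else 0) = M0 from rfl]
      field_simp
      ring
    rw [← Finset.mul_sum, hsum]
    have hid : w / (2 * n) * (1 / 2) ^ k * (n * (α - σ * M - k * σ * (F / n)
          - β * (k * ((M + M0) / n) + k ^ 2 * (F / n ^ 2))
          - β * ((M + M0) / n)) - σ * F - β * (k * (F / n))) =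
        w * (1 / 2) ^ (k + 1) * (α - σ * M - (k + 1) * σ * (F / n)
          - β * ((k + 1) * ((M + M0) / n) + (k ^ 2 + k) * (F / n ^ 2))) := by
      field_simp
      ring
    rw [hid]
    push_cast
    have : (k : ℝ) ^ 2 + k ≤ (k + 1) ^ 2 := by nlinarith [(Nat.cast_nonneg k : (0 : ℝ) ≤ k)]
    gcongr

end Backward

/-! ### Collisions, lost labels and pairs of walks in one level -/

section OneLevel

variable {n m : ℕ} {b : Fin n → Option (Fin m)} {X : Finset (Option (Fin m))} {N K : ℕ}

/-- Splitting off a set of vertices changes the root of the number of collisions by at most the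
size of that set. -/
lemma sqrt_collisionCount_le (f : Fin n → Option (Fin m)) (P : Fin n → Prop) [DecidablePred P] :
    √(collisionCount f) ≤
      √(∑ y, ∑ z, if ¬ P y ∧ ¬ P z ∧ f y = f z then (1 : ℝ) else 0) +
        ∑ y, if P y then (1 : ℝ) else 0 := by
  set S : ℝ := ∑ y, ∑ z, if ¬ P y ∧ ¬ P z ∧ f y = f z then (1 : ℝ) else 0 with hS
  set Z : ℝ := ∑ y, if P y then (1 : ℝ) else 0 with hZ
  have hS0 : 0 ≤ S := Finset.sum_nonneg fun y _ => Finset.sum_nonneg fun z _ => by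
    split_ifs <;> norm_num
  have hZ0 : 0 ≤ Z := Finset.sum_nonneg fun y _ => by split_ifs <;> norm_num
  set c : Option (Fin m) → ℝ := fun o => ∑ z, if ¬ P z ∧ f z = o then (1 : ℝ) else 0 with hc
  have hc0 : ∀ o, 0 ≤ c o := fun o => Finset.sum_nonneg fun z _ => by split_ifs <;> norm_num
  have hcS : ∀ o, c o ≤ √S := by
    intro o
    refine Real.le_sqrt_of_sq_le ?_
    rw [sq, hc]
    dsimp only
    rw [Finset.sum_mul_sum, hS]
    refine Finset.sum_le_sum fun y _ => Finset.sum_le_sum fun z _ => ?_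
    by_cases h1 : ¬ P y ∧ f y = o
    · by_cases h2 : ¬ P z ∧ f z = o
      · rw [if_pos h1, if_pos h2, if_pos ⟨h1.1, h2.1, h1.2.trans h2.2.symm⟩]; norm_num
      · rw [if_neg h2, mul_zero]; split_ifs <;> norm_num
    · rw [if_neg h1, zero_mul]; split_ifs <;> norm_num
  refine Real.sqrt_le_iff.2 ⟨by positivity, ?_⟩
  -- An exceptional vertex shares its label with at most `√S` ordinary ones, so the collisions
  -- number at most `S + 2 Z √S + Z ^ 2`.
  have hmix : ∑ y, (if P y then (1 : ℝ) else 0) * c (f y) ≤ Z * √S := by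
    rw [hZ, Finset.sum_mul]
    refine Finset.sum_le_sum fun y _ => ?_
    have := hcS (f y)
    split_ifs <;> linarith
  have hexp : collisionCount f ≤ S + 2 * ∑ y, (if P y then (1 : ℝ) else 0) * c (f y) + Z * Z := by
    have h1 : ∑ y, (if P y then (1 : ℝ) else 0) * c (f y) =
        ∑ y, ∑ z, (if P y ∧ ¬ P z ∧ f z = f y then (1 : ℝ) else 0) := by
      refine Finset.sum_congr rfl fun y _ => ?_
      rw [hc]; dsimp only
      rw [Finset.mul_sum]
      refine Finset.sum_congr rfl fun z _ => ?_
      by_cases hp : P y <;> simp [hp]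
    have h2 : ∑ y, (if P y then (1 : ℝ) else 0) * c (f y) =
        ∑ y, ∑ z, (if P z ∧ ¬ P y ∧ f y = f z then (1 : ℝ) else 0) := by
      rw [h1, Finset.sum_comm]
    have h3 : Z * Z = ∑ y, ∑ z, (if P y then (1 : ℝ) else 0) * (if P z then (1 : ℝ) else 0) := by
      rw [hZ, Finset.sum_mul_sum]
    rw [two_mul, h3]
    nth_rewrite 1 [h1]
    rw [h2, hS, collisionCount]
    simp only [classCount, ← Finset.sum_add_distrib]
    refine Finset.sum_le_sum fun y _ => Finset.sum_le_sum fun z _ => ?_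
    by_cases hy : P y <;> by_cases hz : P z <;> by_cases he : f z = f y <;>
      simp [hy, hz, he] <;> split_ifs <;> norm_num
  have hsq := Real.sq_sqrt hS0
  nlinarith

lemma collisionCount_pos (hn : 0 < n) : 0 < collisionCount b :=
  lt_of_lt_of_le (by exact_mod_cast hn) (card_le_collisionCount b)

open Classical in
-- Two non-touching walks with equal next labels merge, which gives at most `4 F` such pairs on
-- average. Taking the root makes the touching walks enter linearly, so the expectation of their
-- number suffices and no second moment is needed.
lemma sum_mul_sqrt_collisionCount_nextLabel_le (hn : 0 < n) (hK : n ≤ 2 ^ K)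
    {ν : (Fin m → Fin (n + 1)) → ℝ} {Q : Finset (Option (Fin m))} {w : ℝ}
    (h : IsFreshWeight ν Q (K + K) w) :
    ∑ g, ν g * √(collisionCount (nextLabel b g)) ≤
      w * (2 * √(collisionCount b) + 3 * (collisionCount b / n) + 2 * labelMass b Q) := by
  have hn' : (0 : ℝ) < n := by exact_mod_cast hn
  have hw := h.weight_nonneg
  have hF : 0 < collisionCount b := collisionCount_pos hn
  have hFn := card_le_collisionCount b
  set F := collisionCount b with hFdef
  have hsF : 0 < √F := Real.sqrt_pos.2 hF
  set S : (Fin m → Fin (n + 1)) → ℝ := fun g => ∑ y, ∑ z,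
    if ¬ Touches b g K Q y ∧ ¬ Touches b g K Q z ∧ nextLabel b g y = nextLabel b g z
    then (1 : ℝ) else 0 with hS
  have hS0 : ∀ g, 0 ≤ S g := fun g => Finset.sum_nonneg fun y _ => Finset.sum_nonneg fun z _ => by
    split_ifs <;> norm_num
  have hZ : ∑ g, ν g * (∑ y, if Touches b g K Q y then (1 : ℝ) else 0) ≤
      w * (2 * labelMass b Q + 2 * (F / n) + n * (1 / 2) ^ K) := by
    refine le_trans (le_of_eq ?_)
      (sum_touches_le hn K (ν := fun _ => ν) (fun _ => h.mono (Finset.Subset.refl _) (by omega)))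
    simp only [Finset.mul_sum, mul_ite, mul_one, mul_zero]
    rw [Finset.sum_comm]
  have hSsum : ∑ g, ν g * S g ≤ w * (4 * F) := by
    refine le_trans ?_ (sum_merges_le hn K K h)
    have : ∑ g, ν g * S g = ∑ z, ∑ z', ∑ g, (if ¬ Touches b g K Q z ∧ ¬ Touches b g K Q z' ∧
        nextLabel b g z = nextLabel b g z' then ν g else 0) := by
      simp only [hS, Finset.mul_sum, mul_ite, mul_one, mul_zero]
      rw [Finset.sum_comm]
      refine Finset.sum_congr rfl fun z _ => ?_
      rw [Finset.sum_comm]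
    rw [this]
    refine Finset.sum_le_sum fun z _ => Finset.sum_le_sum fun z' _ =>
      Finset.sum_le_sum fun g _ => ?_
    have h0 := h.nonneg g
    split_ifs with h1 h2 h2
    · exact le_rfl
    · exact absurd (merges_of_nextLabel_eq h1.1 h1.2.1 h1.2.2) h2
    · exact h0
    · exact le_rfl
  have hterm : ∀ g, ν g * √(collisionCount (nextLabel b g)) ≤
      ν g * S g * (1 / (4 * √F)) + ν g * √F +
        ν g * (∑ y, if Touches b g K Q y then (1 : ℝ) else 0) := by
    intro g
    have h1 := sqrt_collisionCount_le (nextLabel b g) (fun y => Touches b g K Q y)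
    -- AM-GM, balanced at `S g = 4 F`, the bound for its mean.
    have h2 : √(S g) ≤ S g * (1 / (4 * √F)) + √F := by
      have hs := Real.sq_sqrt (hS0 g)
      rw [mul_one_div, div_add' _ _ _ (by positivity), le_div_iff₀ (by positivity)]
      nlinarith [sq_nonneg (√(S g) - 2 * √F)]
    have h0 := h.nonneg g
    have := mul_le_mul_of_nonneg_left (h1.trans (add_le_add_left h2 _)) h0
    refine this.trans (le_of_eq (by ring))
  refine (Finset.sum_le_sum fun g _ => hterm g).trans ?_
  rw [Finset.sum_add_distrib, Finset.sum_add_distrib, ← Finset.sum_mul, ← Finset.sum_mul, h.sum_eq]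
  have hA : (∑ g, ν g * S g) * (1 / (4 * √F)) ≤ w * √F := by
    refine (mul_le_mul_of_nonneg_right hSsum (by positivity)).trans (le_of_eq ?_)
    nth_rewrite 1 [← Real.mul_self_sqrt hF.le]
    field_simp
  have hpow : (n : ℝ) * (1 / 2) ^ K ≤ F / n := by
    have h2 : (n : ℝ) ≤ 2 ^ K := by exact_mod_cast hK
    have h3 : (1 : ℝ) ≤ F / n := by rw [le_div_iff₀ hn']; linarith
    refine le_trans ?_ h3
    rw [one_div, inv_pow, ← div_eq_mul_inv, div_le_one (by positivity)]
    exact h2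
  have := mul_le_mul_of_nonneg_left hpow hw
  nlinarith

open Classical in
-- With `none` declared known, losing the label means touching. The label of `u` is fresh, so the
-- walk must first jump to a random vertex; this divides the bound summed over all starting vertices
-- by `2 n`.
lemma sum_nextLabel_eq_none_le (hn : 0 < n) (hK : n ≤ 2 ^ K) {u : Fin n} (hu : b u ≠ none)
    {ν : (Fin m → Fin (n + 1)) → ℝ} {Q : Finset (Option (Fin m))} {w : ℝ} (huQ : b u ∉ Q)
    (h : IsFreshWeight ν Q (K + 1) w) :
    ∑ g, ν g * (if nextLabel b g u = none then 1 else 0) ≤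
      w * (4 * (√(collisionCount b) / n) + 1 / n * labelMass b Q) := by
  have hn' : (0 : ℝ) < n := by exact_mod_cast hn
  have hw := h.weight_nonneg
  have hF : 0 < collisionCount b := collisionCount_pos hn
  have hFn := card_le_collisionCount b
  have hFn2 := collisionCount_le_sq b
  set F := collisionCount b with hFdef
  have hM := labelMass_nonneg b Q
  have huQ' : b u ∉ insert none Q := by simp [hu, huQ]
  have hν' : IsFreshWeight ν (insert none Q) (K + 1) w := h.mono (Finset.subset_insert _ _) le_rfl
  have h1 : ∑ g, ν g * (if nextLabel b g u = none then 1 else 0) ≤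
      ∑ g, (if ∃ j v, b u = some j ∧ some j ∉ insert none Q ∧ g j = Fin.succ v ∧
        Touches b g K (insert (some j) (insert none Q)) v then ν g else 0) := by
    refine Finset.sum_le_sum fun g _ => ?_
    have h0 := h.nonneg g
    split_ifs with h1 h2 h2
    · simp
    · have ht : Touches b g (K + 1) (insert none Q) u :=
        touches_of_nextLabel_eq_none (Finset.mem_insert_self _ _) h1
      rcases ht with ht | ht
      · exact absurd ht huQ'
      · exact absurd ht h2
    · simpa using h0
    · simp
  refine h1.trans (sum_step_le h.nonneg u
    (fun j v g => Touches b g K (insert (some j) (insert none Q)) v) (by positivity) ?_)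
  intro j hj hjQ
  refine (sum_touches_le hn K (fun v => hν'.cond hjQ v)).trans ?_
  have hm1 := labelMass_insert_le b (some j) (insert none Q)
  have hm2 := labelMass_insert_le b none Q
  have hc1 := classCount_le_sqrt b (some j)
  have hc2 := classCount_le_sqrt b none
  have hs1 : 1 ≤ √F := by
    rw [Real.one_le_sqrt]
    have : (1 : ℝ) ≤ n := by exact_mod_cast hn
    linarith
  have hsn : √F ≤ n := Real.sqrt_le_iff.2 ⟨hn'.le, hFn2⟩
  have hFs : F / n ≤ √F := by
    rw [div_le_iff₀ hn']
    nlinarith [Real.mul_self_sqrt hF.le]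
  have hpow : (n : ℝ) * (1 / 2) ^ K ≤ 1 := by
    have h2 : (n : ℝ) ≤ 2 ^ K := by exact_mod_cast hK
    rw [one_div, inv_pow, ← div_eq_mul_inv, div_le_one (by positivity)]
    exact h2
  have hle : 2 * labelMass b (insert (some j) (insert none Q)) + 2 * (F / n)
      + n * (1 / 2) ^ K ≤ 8 * √F + 2 * labelMass b Q := by linarith
  refine (mul_le_mul_of_nonneg_left hle (by positivity)).trans (le_of_eq ?_)
  field_simp
  ring

/-- Two successive backward sums: a `k`-step walk to `z` and then a `k'`-step walk to `z'`. -/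
def pairSum (b : Fin n → Option (Fin m)) (g : Fin m → Fin (n + 1)) (X : Finset (Option (Fin m)))
    (k k' : ℕ) (z z' : Fin n) (Ψ : Fin n → Fin n → ℝ) : ℝ :=
  backSum b g X k (fun Q y => backSum b g X k' (fun _ y' => Ψ y y') Q z') ∅ z

lemma pairSum_const (g : Fin m → Fin (n + 1)) (k k' : ℕ) (z z' : Fin n) (c : ℝ) :
    pairSum b g X k k' z z' (fun _ _ => c) = pairSum b g X k k' z z' (fun _ _ => 1) * c := by
  unfold pairSum
  rw [← backSum_mul]
  simp only [← backSum_mul, one_mul]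

/-- `c` is evaluated after both walks have been revealed, hence is averaged over the inputs they
leave fresh. The bound for the second walk serves as the hypothesis on `Θ` for the first. -/
lemma sum_mul_pairSum_le (hn : 0 < n) {α σ : ℝ} (hα : 0 ≤ α) (hσ : 0 ≤ σ)
    (c : (Fin m → Fin (n + 1)) → ℝ)
    (hc : ∀ (ν : (Fin m → Fin (n + 1)) → ℝ) (Q : Finset (Option (Fin m))) (w : ℝ),
      IsFreshWeight ν Q N w → Disjoint Q X → ∑ g, ν g * c g ≤ w * (α + σ * labelMass b Q))
    (k k' : ℕ) (z z' : Fin n) {p : (Fin m → Fin (n + 1)) → ℝ}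
    (hp : IsFreshWeight p ∅ (N + k' + k) 1) :
    ∑ g, p g * pairSum b g X k k' z z' (fun _ _ => c g) ≤
      (1 / 2) ^ (k + k') * (α + σ * ((k + k') * (collisionCount b / n))) := by
  have hF := collisionCount_nonneg b
  have := sum_mul_backSum_le (b := b) (X := X) (N := N + k') hn
    (α := (1 / 2) ^ k' * (α + σ * (k' * (collisionCount b / n)))) (σ := (1 / 2) ^ k' * σ)
    (by positivity) (by positivity) (fun g Q _ => backSum b g X k' (fun _ _ => c g) Q z')
    (fun ν Q w y hν hQ => ?_) k z hp (Finset.disjoint_empty_left _)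
  · refine this.trans (le_of_eq ?_)
    rw [labelMass_empty, pow_add]; ring
  · refine (sum_mul_backSum_le (b := b) hn hα hσ (fun g _ _ => c g)
      (fun ν Q w _ hν hQ => hc ν Q w hν hQ) k' z' hν hQ).trans (le_of_eq ?_)
    ring

lemma le_sum_mul_pairSum (hn : 0 < n) (hX : none ∈ X) (k k' : ℕ) (z z' : Fin n)
    {p : (Fin m → Fin (n + 1)) → ℝ} (hp : IsFreshWeight p ∅ (k' + k) 1) :
    (1 / 2) ^ (k + k') * (1 - (k + k') * (labelMass b X / n)
        - (k + k') ^ 2 * (collisionCount b / n ^ 2)) ≤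
      ∑ g, p g * pairSum b g X k k' z z' (fun _ _ => 1) := by
  have hn' : (0 : ℝ) < n := by exact_mod_cast hn
  have hF := collisionCount_nonneg b
  have hM0 := labelMass_nonneg b X
  have := le_sum_mul_backSum (b := b) (X := X) (N := k') hn
    (α := (1 / 2) ^ k' * (1 - k' * (labelMass b X / n) - k' ^ 2 * (collisionCount b / n ^ 2)))
    (σ := (1 / 2) ^ k' * (k' / n)) (β := (1 / 2) ^ k')
    (mul_le_of_le_one_right (by positivity) (by
      have h1 : 0 ≤ k' * (labelMass b X / n) := by positivity
      have h2 : 0 ≤ (k' : ℝ) ^ 2 * (collisionCount b / n ^ 2) := by positivity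
      linarith)) (by positivity) (by positivity) hX
    (fun g Q _ => backSum b g X k' (fun _ _ => 1) Q z')
    (fun ν Q w y hν hQ => ?_) k z hp (Finset.disjoint_empty_left _)
  · refine le_trans ?_ this
    rw [labelMass_empty, pow_add]
    -- The nested bounds lose only `k ^ 2 + k k' + k' ^ 2`; the spare `k k'` of `(k + k') ^ 2` is
    -- dropped.
    have : 0 ≤ (1 / 2 : ℝ) ^ k * (1 / 2) ^ k' * (k * k' * (collisionCount b / n ^ 2)) := by
      positivity
    have he : 1 * (1 / 2 : ℝ) ^ k * ((1 / 2) ^ k' * (1 - k' * (labelMass b X / n)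
        - k' ^ 2 * (collisionCount b / n ^ 2)) - (1 / 2) ^ k' * (k' / n) * 0
        - k * ((1 / 2) ^ k' * (k' / n)) * (collisionCount b / n)
        - (1 / 2) ^ k' * (k * ((0 + labelMass b X) / n) + k ^ 2 * (collisionCount b / n ^ 2)))
        = (1 / 2) ^ k * (1 / 2) ^ k' * (1 - (k + k') * (labelMass b X / n)
        - (k + k') ^ 2 * (collisionCount b / n ^ 2)) +
        (1 / 2 : ℝ) ^ k * (1 / 2) ^ k' * (k * k' * (collisionCount b / n ^ 2)) := by
      field_simp
      ring
    rw [he]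
    linarith
  · refine le_trans (le_of_eq ?_) (le_sum_mul_backSum (b := b) (N := 0) hn (α := 1) (σ := 0)
      (β := 1) le_rfl le_rfl zero_le_one hX (fun g _ _ => 1) (fun ν Q w _ hν hQ => ?_) k' z'
      (by simpa using hν) hQ)
    · ring
    · simp [hν.sum_eq]

end OneLevel

/-! ### The potential grows fourfold per level -/

section Potential

variable {n m : ℕ}

/-- The labels that the backward walks towards `u` and `v` avoid. -/
def avoidedLabels (b : Fin n → Option (Fin m)) (u v : Fin n) : Finset (Option (Fin m)) :=
  {none, b u, b v}

/-- The weights on pairs `(x, x')` after one more level: the walk from `x` leads to some `z` and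
the walk from `x'` to some `z'`, in fewer than `K` steps each, and the pair `(z, z')` carries its
old weight. -/
def nextPairWeight (b : Fin n → Option (Fin m)) (g : Fin m → Fin (n + 1)) (K : ℕ) (u v : Fin n)
    (τ : Fin n → Fin n → ℝ) (x x' : Fin n) : ℝ :=
  ∑ k ∈ Finset.range K, ∑ k' ∈ Finset.range K, ∑ z, ∑ z', τ z z' *
    pairSum b g (avoidedLabels b u v) k k' z z' (fun y y' => if y = x ∧ y' = x' then 1 else 0)

/-- The total weight of pairs, damped by the number of collisions, and `0` if `u` has lost its
label. -/
noncomputable def potential (A : ℝ) (b : Fin n → Option (Fin m)) (u : Fin n)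
    (τ : Fin n → Fin n → ℝ) : ℝ :=
  (∑ x, ∑ x', τ x x') *
    (if b u = none then 0 else max 0 (1 - A * (√(collisionCount b) / n)))

lemma sum_pairSum (b : Fin n → Option (Fin m)) (g : Fin m → Fin (n + 1))
    (X : Finset (Option (Fin m))) (k k' : ℕ) (z z' : Fin n) :
    ∑ x, ∑ x', pairSum b g X k k' z z' (fun y y' => if y = x ∧ y' = x' then 1 else 0) =
      pairSum b g X k k' z z' (fun _ _ => 1) := by
  unfold pairSum
  simp only [← backSum_sum]
  congr 1
  ext Q y
  congr 1
  ext Q y'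
  simp [ite_and]

lemma sum_nextPairWeight (b : Fin n → Option (Fin m)) (g : Fin m → Fin (n + 1)) (K : ℕ)
    (u v : Fin n) (τ : Fin n → Fin n → ℝ) :
    ∑ x, ∑ x', nextPairWeight b g K u v τ x x' =
      ∑ k ∈ Finset.range K, ∑ k' ∈ Finset.range K, ∑ z, ∑ z', τ z z' *
        pairSum b g (avoidedLabels b u v) k k' z z' (fun _ _ => 1) := by
  simp only [← sum_pairSum, Finset.mul_sum, nextPairWeight]
  rw [← Finset.sum_product', Finset.sum_comm]
  refine Finset.sum_congr rfl fun k _ => ?_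
  rw [Finset.sum_comm]
  refine Finset.sum_congr rfl fun k' _ => ?_
  rw [Finset.sum_comm]
  refine Finset.sum_congr rfl fun z _ => ?_
  rw [Finset.sum_comm]
  refine Finset.sum_congr rfl fun z' _ => ?_
  rw [← Finset.sum_product']

lemma nextPairWeight_nonneg (b : Fin n → Option (Fin m)) (g : Fin m → Fin (n + 1)) (K : ℕ)
    (u v : Fin n) {τ : Fin n → Fin n → ℝ} (hτ : ∀ x x', 0 ≤ τ x x') (x x' : Fin n) :
    0 ≤ nextPairWeight b g K u v τ x x' := by
  refine Finset.sum_nonneg fun k _ => Finset.sum_nonneg fun k' _ => Finset.sum_nonneg fun z _ =>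
    Finset.sum_nonneg fun z' _ => mul_nonneg (hτ z z') ?_
  refine backSum_nonneg _ (fun Q y => backSum_nonneg _ (fun Q y' => ?_) _ _ _) _ _ _
  dsimp only
  split_ifs <;> norm_num

lemma sum_range_half_pow (K : ℕ) :
    ∑ k ∈ Finset.range K, (1 / 2 : ℝ) ^ k = 2 - 2 * (1 / 2) ^ K := by
  induction K with
  | zero => simp
  | succ K ih => rw [Finset.sum_range_succ, ih, pow_succ]; ring

lemma sum_range_sq_half_pow_le (K : ℕ) :
    ∑ k ∈ Finset.range K, (1 / 2 : ℝ) ^ k * k ^ 2 ≤ 6 := by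
  have : ∑ k ∈ Finset.range K, (1 / 2 : ℝ) ^ k * k ^ 2
      = 6 - 2 * ((K : ℝ) ^ 2 + 2 * K + 3) * (1 / 2) ^ K := by
    induction K with
    | zero => norm_num
    | succ K ih => rw [Finset.sum_range_succ, ih, pow_succ]; push_cast; ring
  rw [this]
  have : 0 ≤ 2 * ((K : ℝ) ^ 2 + 2 * K + 3) * (1 / 2) ^ K := by positivity
  linarith

/-- The constant is `320 = 8 + 24 + 288`: the truncation of the geometric series, the constant part
of the error, and its quadratic part. One quarter of it is the `80` in the recursion for `A`. -/
lemma le_sum_sum_half_pow {K : ℕ} {s P : ℝ} (hs : (1 / 2 : ℝ) ^ K ≤ s) (hP0 : 0 ≤ P)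
    (hP1 : P ≤ 1) :
    4 * P - 320 * s ≤ ∑ k ∈ Finset.range K, ∑ k' ∈ Finset.range K,
      (1 / 2 : ℝ) ^ (k + k') * (P - s * (6 * (1 + 2 * k ^ 2 + 2 * k' ^ 2))) := by
  have hs0 : 0 ≤ s := le_trans (by positivity) hs
  set G := ∑ k ∈ Finset.range K, (1 / 2 : ℝ) ^ k with hG
  set H := ∑ k ∈ Finset.range K, (1 / 2 : ℝ) ^ k * (k : ℝ) ^ 2 with hH
  have hGe : G = 2 - 2 * (1 / 2) ^ K := sum_range_half_pow K
  have hH6 : H ≤ 6 := sum_range_sq_half_pow_le K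
  have hH0 : 0 ≤ H := Finset.sum_nonneg fun k _ => by positivity
  have hG0 : 0 ≤ G := Finset.sum_nonneg fun k _ => by positivity
  have hd0 : (0 : ℝ) < (1 / 2) ^ K := by positivity
  have hG2 : G ≤ 2 := by rw [hGe]; linarith
  have hGG : 4 - 8 * s ≤ G * G := by rw [hGe]; nlinarith [sq_nonneg ((1 / 2 : ℝ) ^ K)]
  have hsum : ∑ k ∈ Finset.range K, ∑ k' ∈ Finset.range K,
      (1 / 2 : ℝ) ^ (k + k') * (P - s * (6 * (1 + 2 * k ^ 2 + 2 * k' ^ 2))) =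
      G * G * (P - 6 * s) - 24 * s * (G * H) := by
    have hGG' : G * G = ∑ k ∈ Finset.range K, ∑ k' ∈ Finset.range K,
        (1 / 2 : ℝ) ^ k * (1 / 2) ^ k' := by rw [hG, Finset.sum_mul_sum]
    have hGH : G * H = ∑ k ∈ Finset.range K, ∑ k' ∈ Finset.range K,
        (1 / 2 : ℝ) ^ k * ((1 / 2) ^ k' * (k' : ℝ) ^ 2) := by rw [hG, hH, Finset.sum_mul_sum]
    have hHG : G * H = ∑ k ∈ Finset.range K, ∑ k' ∈ Finset.range K,
        (1 / 2 : ℝ) ^ k * (k : ℝ) ^ 2 * (1 / 2) ^ k' := by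
      rw [mul_comm, hG, hH, Finset.sum_mul_sum]
    rw [show G * G * (P - 6 * s) - 24 * s * (G * H) =
      (P - 6 * s) * (G * G) - 12 * s * (G * H) - 12 * s * (G * H) by ring]
    nth_rewrite 2 [hGH]
    rw [hHG, hGG']
    simp only [Finset.mul_sum, ← Finset.sum_sub_distrib]
    refine Finset.sum_congr rfl fun k _ => Finset.sum_congr rfl fun k' _ => ?_
    rw [pow_add]; ring
  rw [hsum]
  have h1 : G * H ≤ 12 := by nlinarith
  have h2 : G * G ≤ 4 := by nlinarith
  nlinarith [mul_nonneg hs0 (sub_nonneg.2 h1), mul_nonneg hs0 (sub_nonneg.2 h2),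
    mul_nonneg hP0 (sub_nonneg.2 hGG), mul_nonneg hs0 (sub_nonneg.2 hP1)]

/-- The term `2 * A * s` stays separate since it drives the recursion `A ↦ 2 * A + 80`. As `A * s ≤
1 / 2`, all other losses fit into `s (i ^ 2 + 5 i + 11 / 2)` with `i = k + k'`, free of `A`. -/
lemma one_level_error_le {s A x : ℝ} (hs0 : 0 ≤ s) (hs1 : s ≤ 1)
    (hAs : (2 * A + 80) * s ≤ 1) (k k' : ℕ) (hx : x ≤ 3 * s) :
    1 - 2 * A * s - s * (6 * (1 + 2 * (k : ℝ) ^ 2 + 2 * (k' : ℝ) ^ 2)) ≤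
      (1 - (k + k') * x - (k + k') ^ 2 * s ^ 2)
        - A * (2 * s + 3 * s ^ 2 + 2 * (k + k') * s ^ 2) - (4 * s + (k + k') * s ^ 2) := by
  set i : ℝ := k + k' with hi
  have hi0 : 0 ≤ i := by positivity
  have hss : s ^ 2 ≤ s := by nlinarith
  have hAs2 : A * s ≤ 1 / 2 := by linarith
  have hAss : A * s ^ 2 ≤ s / 2 := by nlinarith
  have g1 : i * x ≤ i * (3 * s) := by gcongr
  have g2 : i ^ 2 * s ^ 2 ≤ i ^ 2 * s := by gcongr
  have g3 : i * s ^ 2 ≤ i * s := by gcongr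
  have g4 : i * (A * s ^ 2) ≤ i * (s / 2) := by gcongr
  have hisq : i ^ 2 ≤ 2 * k ^ 2 + 2 * k' ^ 2 := by
    rw [hi]; nlinarith [sq_nonneg ((k : ℝ) - k')]
  have hii : i ≤ i ^ 2 := by
    rw [hi]; exact_mod_cast Nat.le_self_pow two_ne_zero (k + k')
  have hcoef : i ^ 2 + 5 * i + 11 / 2 ≤ 6 * (1 + 2 * (k : ℝ) ^ 2 + 2 * (k' : ℝ) ^ 2) := by linarith
  have := mul_le_mul_of_nonneg_left hcoef hs0
  rw [show A * (2 * s + 3 * s ^ 2 + 2 * i * s ^ 2) =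
    2 * A * s + 3 * (A * s ^ 2) + 2 * (i * (A * s ^ 2)) by ring]
  rw [show s * (i ^ 2 + 5 * i + 11 / 2) = i ^ 2 * s + 5 * (i * s) + 11 / 2 * s by ring] at this
  linarith

/-- One level multiplies the expected potential by at least `4`. -/
theorem four_mul_potential_le {b : Fin n → Option (Fin m)} {K : ℕ} (hn : 0 < n) (hK : n ≤ 2 ^ K)
    {p : (Fin m → Fin (n + 1)) → ℝ} (hp : IsFreshWeight p ∅ (4 * K) 1)
    (u v : Fin n) {τ : Fin n → Fin n → ℝ} (hτ : ∀ x x', 0 ≤ τ x x') {A : ℝ} (hA : 0 ≤ A) :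
    4 * potential (2 * A + 80) b u τ ≤
      ∑ g, p g * potential A (nextLabel b g) u (nextPairWeight b g K u v τ) := by
  classical
  have hn' : (0 : ℝ) < n := by exact_mod_cast hn
  have hF : 0 < collisionCount b := collisionCount_pos hn
  have hFn := card_le_collisionCount b
  set F := collisionCount b with hFdef
  set s := √F / n with hs
  have hs0 : 0 ≤ s := by positivity
  have hs2 : F / n ^ 2 = s ^ 2 := by rw [hs, div_pow, Real.sq_sqrt hF.le]
  have hs1 : s ≤ 1 := by
    rw [hs, div_le_one hn']
    exact Real.sqrt_le_iff.2 ⟨hn'.le, collisionCount_le_sq b⟩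
  have hpos : ∀ g, 0 ≤ p g * potential A (nextLabel b g) u (nextPairWeight b g K u v τ) := by
    intro g
    refine mul_nonneg (hp.nonneg g) (mul_nonneg ?_ ?_)
    · exact Finset.sum_nonneg fun x _ => Finset.sum_nonneg fun x' _ =>
        nextPairWeight_nonneg b g K u v hτ x x'
    · split_ifs
      · exact le_rfl
      · exact le_max_left _ _
  have hzero : potential (2 * A + 80) b u τ ≤ 0 → 4 * potential (2 * A + 80) b u τ ≤
      ∑ g, p g * potential A (nextLabel b g) u (nextPairWeight b g K u v τ) := fun h =>
    le_trans (by linarith) (Finset.sum_nonneg fun g _ => hpos g)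
  by_cases hu : b u = none
  · exact hzero (by simp [potential, hu])
  by_cases hAs : 1 ≤ (2 * A + 80) * s
  · refine hzero ?_
    rw [potential, if_neg hu, max_eq_left (by linarith), mul_zero]
  push Not at hAs
  set T := ∑ x, ∑ x', τ x x' with hT
  have hT0 : 0 ≤ T := Finset.sum_nonneg fun x _ => Finset.sum_nonneg fun x' _ => hτ x x'
  rw [potential, if_neg hu, max_eq_right (by linarith)]
  set X := avoidedLabels b u v with hX
  have hXnone : none ∈ X := by simp [hX, avoidedLabels]
  have hXu : b u ∈ X := by simp [hX, avoidedLabels]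
  have hXmass : labelMass b X / n ≤ 3 * s := by
    have h1 := labelMass_insert_le b none {b u, b v}
    have h2 := labelMass_insert_le b (b u) {b v}
    have h3 := labelMass_insert_le b (b v) ∅
    rw [labelMass_empty] at h3
    have h4 : labelMass b X ≤ 3 * √F := by
      rw [hX, avoidedLabels]
      have := classCount_le_sqrt b none
      have := classCount_le_sqrt b (b u)
      have := classCount_le_sqrt b (b v)
      have h5 : labelMass b (insert (b v) ∅) = labelMass b {b v} := rfl
      linarith
    rw [hs, ← mul_div_assoc]
    gcongr
  have hhalf : (1 / 2 : ℝ) ^ K ≤ s := by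
    have h2 : (n : ℝ) ≤ 2 ^ K := by exact_mod_cast hK
    have h3 : 1 ≤ √F := by
      rw [Real.one_le_sqrt]
      have : (1 : ℝ) ≤ n := by exact_mod_cast hn
      linarith
    rw [one_div, inv_pow, hs, ← one_div]
    exact div_le_div₀ (by positivity) h3 hn' h2
  -- The indicator that `u` loses its label is subtracted instead of entering as a factor, so that
  -- three separate expectations suffice.
  have hone : ∀ k ∈ Finset.range K, ∀ k' ∈ Finset.range K, ∀ z z',
      (1 / 2 : ℝ) ^ (k + k') * (1 - 2 * A * s - s * (6 * (1 + 2 * k ^ 2 + 2 * k' ^ 2))) ≤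
      ∑ g, p g * (pairSum b g X k k' z z' (fun _ _ => 1) *
        (1 - A * (√(collisionCount (nextLabel b g)) / n)
          - (if nextLabel b g u = none then 1 else 0))) := by
    intro k hk k' hk' z z'
    rw [Finset.mem_range] at hk hk'
    have e1 := le_sum_mul_pairSum (b := b) hn hXnone k k' z z'
      (hp.mono (Finset.Subset.refl _) (by omega))
    -- The two backward walks reveal fewer than `2 K` inputs and the collision estimate needs `K +
    -- K` more, whence the budget `4 * K`.
    have e2 := sum_mul_pairSum_le (b := b) (X := X) (N := K + K) hn
      (α := 2 * √F + 3 * (F / n)) (σ := 2) (by positivity) (by norm_num)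
      (fun g => √(collisionCount (nextLabel b g)))
      (fun ν Q w hν _ => sum_mul_sqrt_collisionCount_nextLabel_le hn hK hν)
      k k' z z' (hp.mono (Finset.Subset.refl _) (by omega))
    have e3 := sum_mul_pairSum_le (b := b) (X := X) (N := K + 1) hn
      (α := 4 * s) (σ := 1 / n) (by positivity) (by positivity)
      (fun g => if nextLabel b g u = none then 1 else 0)
      (fun ν Q w hν hQ => sum_nextLabel_eq_none_le hn hK hu
        (fun hc => Finset.disjoint_left.1 hQ hc hXu) hν)
      k k' z z' (hp.mono (Finset.Subset.refl _) (by omega))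
    rw [← hFdef] at e1 e2 e3
    have hsplit : ∑ g, p g * (pairSum b g X k k' z z' (fun _ _ => 1) *
        (1 - A * (√(collisionCount (nextLabel b g)) / n)
          - (if nextLabel b g u = none then 1 else 0))) =
        ∑ g, p g * pairSum b g X k k' z z' (fun _ _ => 1)
        - A / n * ∑ g, p g * pairSum b g X k k' z z'
            (fun _ _ => √(collisionCount (nextLabel b g)))
        - ∑ g, p g * pairSum b g X k k' z z'
            (fun _ _ => if nextLabel b g u = none then 1 else 0) := by
      rw [Finset.mul_sum, ← Finset.sum_sub_distrib, ← Finset.sum_sub_distrib]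
      refine Finset.sum_congr rfl fun g _ => ?_
      rw [pairSum_const g k k' z z' (√(collisionCount (nextLabel b g))),
        pairSum_const g k k' z z' (if nextLabel b g u = none then 1 else 0)]
      ring
    rw [hsplit]
    have e2' := mul_le_mul_of_nonneg_left e2 (show 0 ≤ A / n by positivity)
    set d := (1 / 2 : ℝ) ^ (k + k') with hd
    have hd0 : 0 ≤ d := by positivity
    set i : ℝ := k + k' with hi
    have hi0 : 0 ≤ i := by positivity
    have f2 : A / n * (d * (2 * √F + 3 * (F / n) + 2 * (i * (F / n)))) =
        d * (A * (2 * s + 3 * s ^ 2 + 2 * i * s ^ 2)) := by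
      rw [← hs2, hs]; field_simp
    have f3 : d * (4 * s + 1 / n * (i * (F / n))) = d * (4 * s + i * s ^ 2) := by
      rw [← hs2]; field_simp
    rw [f2] at e2'
    rw [f3] at e3
    rw [hs2] at e1
    have hfin := one_level_error_le hs0 hs1 hAs.le k k' hXmass
    rw [← hi] at hfin
    have hmul : d * (1 - 2 * A * s - s * (6 * (1 + 2 * k ^ 2 + 2 * k' ^ 2))) ≤
        d * (1 - i * (labelMass b X / n) - i ^ 2 * s ^ 2)
        - d * (A * (2 * s + 3 * s ^ 2 + 2 * i * s ^ 2)) - d * (4 * s + i * s ^ 2) := by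
      rw [← mul_sub, ← mul_sub]
      exact mul_le_mul_of_nonneg_left hfin hd0
    linarith
  have hlow : T * (4 * (1 - 2 * A * s) - 320 * s) ≤
      ∑ g, p g * ((∑ x, ∑ x', nextPairWeight b g K u v τ x x') *
        (1 - A * (√(collisionCount (nextLabel b g)) / n)
          - (if nextLabel b g u = none then 1 else 0))) := by
    have hexp : ∑ g, p g * ((∑ x, ∑ x', nextPairWeight b g K u v τ x x') *
        (1 - A * (√(collisionCount (nextLabel b g)) / n)
          - (if nextLabel b g u = none then 1 else 0))) =
        ∑ k ∈ Finset.range K, ∑ k' ∈ Finset.range K, ∑ z, ∑ z', τ z z' *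
          ∑ g, p g * (pairSum b g X k k' z z' (fun _ _ => 1) *
        (1 - A * (√(collisionCount (nextLabel b g)) / n)
          - (if nextLabel b g u = none then 1 else 0))) := by
      simp only [sum_nextPairWeight, Finset.sum_mul, Finset.mul_sum]
      rw [Finset.sum_comm]
      refine Finset.sum_congr rfl fun k _ => ?_
      rw [Finset.sum_comm]
      refine Finset.sum_congr rfl fun k' _ => ?_
      rw [Finset.sum_comm]
      refine Finset.sum_congr rfl fun z _ => ?_
      rw [Finset.sum_comm]
      refine Finset.sum_congr rfl fun z' _ => Finset.sum_congr rfl fun g _ => ?_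
      ring
    rw [hexp]
    have hb := le_sum_sum_half_pow (K := K) (P := 1 - 2 * A * s) hhalf (by linarith)
      (by nlinarith [mul_nonneg hA hs0])
    refine (mul_le_mul_of_nonneg_left hb hT0).trans ?_
    rw [Finset.mul_sum]
    refine Finset.sum_le_sum fun k hk => ?_
    rw [Finset.mul_sum]
    refine Finset.sum_le_sum fun k' hk' => ?_
    rw [hT, Finset.sum_mul]
    refine Finset.sum_le_sum fun z _ => ?_
    rw [Finset.sum_mul]
    exact Finset.sum_le_sum fun z' _ =>
      mul_le_mul_of_nonneg_left (hone k hk k' hk' z z') (hτ z z')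
  refine le_trans (le_trans (le_of_eq (by ring)) hlow) (Finset.sum_le_sum fun g _ => ?_)
  refine mul_le_mul_of_nonneg_left (mul_le_mul_of_nonneg_left ?_ ?_) (hp.nonneg g)
  · split_ifs
    · have : 0 ≤ A * (√(collisionCount (nextLabel b g)) / n) := by positivity
      linarith
    · rw [sub_zero]; exact le_max_right _ _
  · exact Finset.sum_nonneg fun x _ => Finset.sum_nonneg fun x' _ =>
      nextPairWeight_nonneg b g K u v hτ x x'

end Potential

/-! ### Pair weights count each pair at most once -/

section Support

variable {n m : ℕ} {b : Fin n → Option (Fin m)} {g : Fin m → Fin (n + 1)}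
  {X : Finset (Option (Fin m))}

variable (b g) in
/-- The step `y ↦ g (b y)` leads from `y` to `z`. -/
def StepTo (y z : Fin n) : Prop := ∃ j, b y = some j ∧ g j = z.succ

lemma StepTo.unique {y z z' : Fin n} (h : StepTo b g y z) (h' : StepTo b g y z') : z = z' := by
  obtain ⟨j, h1, h2⟩ := h
  obtain ⟨j', h3, h4⟩ := h'
  rw [h1] at h3
  obtain rfl := Option.some.inj h3
  rw [h2] at h4
  exact Fin.succ_injective _ h4

lemma StepTo.nextLabel_eq {y z : Fin n} (h : StepTo b g y z) :
    nextLabel b g y = nextLabel b g z := by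
  obtain ⟨j, h1, h2⟩ := h
  exact nextLabel_of_succ h1 h2

variable (b g X) in
/-- There is a walk of `k` steps from `x` to `z` that leaves only from labels outside `X`. -/
def AvoidingWalk : ℕ → Fin n → Fin n → Prop
  | 0, x, z => x = z
  | k + 1, x, z => ∃ y, b y ∉ X ∧ StepTo b g y z ∧ AvoidingWalk k x y

lemma AvoidingWalk.unique {k : ℕ} {x z z' : Fin n} (h : AvoidingWalk b g X k x z)
    (h' : AvoidingWalk b g X k x z') : z = z' := by
  induction k generalizing z z' with
  | zero => exact h.symm.trans h'
  | succ k ih =>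
    obtain ⟨y, -, h1, h2⟩ := h
    obtain ⟨y', -, h3, h4⟩ := h'
    obtain rfl := ih h2 h4
    exact h1.unique h3

lemma AvoidingWalk.drop {k i : ℕ} {x z z' : Fin n} (h : AvoidingWalk b g X k x z)
    (h' : AvoidingWalk b g X (k + i) x z') : AvoidingWalk b g X i z z' := by
  induction i generalizing z' with
  | zero => exact h.unique h'
  | succ i ih =>
    obtain ⟨y, h1, h2, h3⟩ := h'
    exact ⟨y, h1, h2, ih h3⟩

lemma AvoidingWalk.start_notMem {i : ℕ} {z z' : Fin n} (h : AvoidingWalk b g X (i + 1) z z') :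
    b z ∉ X := by
  induction i generalizing z' with
  | zero =>
    obtain ⟨y, h1, -, h3⟩ := h
    rw [show z = y from h3]; exact h1
  | succ i ih =>
    obtain ⟨y, -, -, h3⟩ := h
    exact ih h3

lemma AvoidingWalk.length_le {k k' : ℕ} {x z z' : Fin n} (h : AvoidingWalk b g X k x z)
    (h' : AvoidingWalk b g X k' x z') (hz : b z ∈ X) : k' ≤ k := by
  by_contra hlt
  obtain ⟨i, rfl⟩ : ∃ i, k' = k + (i + 1) := ⟨k' - k - 1, by omega⟩
  exact (h.drop h').start_notMem hz

/-- A walk that has arrived at a label of `X` cannot continue, so its start determines when and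
where it ends. -/
lemma AvoidingWalk.eq_of_mem {k k' : ℕ} {x z z' : Fin n} (h : AvoidingWalk b g X k x z)
    (h' : AvoidingWalk b g X k' x z') (hz : b z ∈ X) (hz' : b z' ∈ X) : k = k' ∧ z = z' := by
  obtain rfl := le_antisymm (h'.length_le h hz') (h.length_le h' hz)
  exact ⟨rfl, h.unique h'⟩

lemma AvoidingWalk.reflTransGen {k : ℕ} {x z : Fin n} (h : AvoidingWalk b g X k x z) :
    Relation.ReflTransGen (StepTo b g) x z := by
  induction k generalizing z with
  | zero => rw [show x = z from h]
  | succ k ih =>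
    obtain ⟨y, -, h2, h3⟩ := h
    exact (ih h3).tail h2

lemma reflTransGen_stepTo_nextLabel_eq {x z : Fin n}
    (h : Relation.ReflTransGen (StepTo b g) x z) : nextLabel b g x = nextLabel b g z := by
  induction h with
  | refl => rfl
  | tail _ h2 ih => exact ih.trans h2.nextLabel_eq

lemma exists_avoidingWalk_of_backSum_ne_zero {Ψ : Finset (Option (Fin m)) → Fin n → ℝ} {k : ℕ}
    {Q : Finset (Option (Fin m))} {z : Fin n} (h : backSum b g X k Ψ Q z ≠ 0) :
    ∃ Q' x, Ψ Q' x ≠ 0 ∧ AvoidingWalk b g X k x z := by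
  induction k generalizing Q z with
  | zero => exact ⟨Q, z, h, rfl⟩
  | succ k ih =>
    obtain ⟨y, -, hy⟩ := Finset.exists_ne_zero_of_sum_ne_zero h
    obtain ⟨⟨h1, h2, h3⟩, hy⟩ := ite_ne_right_iff.1 hy
    obtain ⟨Q', x, hx, hw⟩ := ih hy
    exact ⟨Q', x, hx, y, h2, h3, hw⟩

lemma sum_le_one_of_unique_ne_zero {ι : Type*} {s : Finset ι} {f : ι → ℝ}
    (h1 : ∀ i ∈ s, f i ≤ 1) (h2 : ∀ i ∈ s, ∀ j ∈ s, f i ≠ 0 → f j ≠ 0 → i = j) :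
    ∑ i ∈ s, f i ≤ 1 := by
  by_cases h : ∃ i ∈ s, f i ≠ 0
  · obtain ⟨i, hi, hfi⟩ := h
    rw [Finset.sum_eq_single_of_mem i hi]
    · exact h1 i hi
    · intro j hj hji
      by_contra hfj
      exact hji (h2 j hj i hi hfj hfi)
  · push Not at h
    rw [Finset.sum_eq_zero h]
    exact zero_le_one

lemma backSum_le_one {Ψ : Finset (Option (Fin m)) → Fin n → ℝ} {x : Fin n}
    (h0 : ∀ Q y, Ψ Q y ≠ 0 → y = x) (h1 : ∀ Q y, Ψ Q y ≤ 1) (k : ℕ)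
    (Q : Finset (Option (Fin m))) (z : Fin n) : backSum b g X k Ψ Q z ≤ 1 := by
  induction k generalizing Q z with
  | zero => exact h1 _ _
  | succ k ih =>
    refine sum_le_one_of_unique_ne_zero (fun y _ => ?_) (fun y _ y' _ hy hy' => ?_)
    · split_ifs
      · exact ih _ _
      · exact zero_le_one
    · obtain ⟨Q1, x1, hx1, hw1⟩ :=
        exists_avoidingWalk_of_backSum_ne_zero (ite_ne_right_iff.1 hy).2
      obtain ⟨Q2, x2, hx2, hw2⟩ :=
        exists_avoidingWalk_of_backSum_ne_zero (ite_ne_right_iff.1 hy').2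
      obtain rfl := h0 _ _ hx1
      obtain rfl := h0 _ _ hx2
      exact hw1.unique hw2

lemma avoidingWalk_of_pairSum_ne_zero {k k' : ℕ} {x x' z z' : Fin n}
    (h : pairSum b g X k k' z z' (fun y y' => if y = x ∧ y' = x' then 1 else 0) ≠ 0) :
    AvoidingWalk b g X k x z ∧ AvoidingWalk b g X k' x' z' := by
  obtain ⟨Q, y, hy, hw⟩ := exists_avoidingWalk_of_backSum_ne_zero h
  obtain ⟨Q', y', hy', hw'⟩ := exists_avoidingWalk_of_backSum_ne_zero hy
  obtain ⟨⟨rfl, rfl⟩, -⟩ := ite_ne_right_iff.1 hy'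
  exact ⟨hw, hw'⟩

lemma pairSum_le_one (k k' : ℕ) (x x' z z' : Fin n) :
    pairSum b g X k k' z z' (fun y y' => if y = x ∧ y' = x' then 1 else 0) ≤ 1 := by
  refine backSum_le_one (x := x) (fun Q y hy => ?_) (fun Q y => ?_) _ _ _
  · obtain ⟨Q', y', hy', -⟩ := exists_avoidingWalk_of_backSum_ne_zero hy
    exact (ite_ne_right_iff.1 hy').1.1
  · refine backSum_le_one (x := x') (fun Q y' hy => (ite_ne_right_iff.1 hy).1.2)
      (fun Q y' => ?_) _ _ _
    dsimp only
    split_ifs <;> norm_num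

variable {K : ℕ} {u v : Fin n} {τ : Fin n → Fin n → ℝ}

lemma exists_of_nextPairWeight_ne_zero {x x' : Fin n}
    (h : nextPairWeight b g K u v τ x x' ≠ 0) :
    ∃ z z', τ z z' ≠ 0 ∧ Relation.ReflTransGen (StepTo b g) x z ∧
      Relation.ReflTransGen (StepTo b g) x' z' := by
  obtain ⟨k, -, h⟩ := Finset.exists_ne_zero_of_sum_ne_zero h
  obtain ⟨k', -, h⟩ := Finset.exists_ne_zero_of_sum_ne_zero h
  obtain ⟨z, -, h⟩ := Finset.exists_ne_zero_of_sum_ne_zero h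
  obtain ⟨z', -, h⟩ := Finset.exists_ne_zero_of_sum_ne_zero h
  have := avoidingWalk_of_pairSum_ne_zero (right_ne_zero_of_mul h)
  exact ⟨z, z', left_ne_zero_of_mul h, this.1.reflTransGen, this.2.reflTransGen⟩

/-- Here avoiding `b u` and `b v` pays off: the endpoints `z`, `z'` in the support of `τ` carry
these labels, so `x`, `x'` determine both endpoints and both lengths, and only one summand can be
nonzero. -/
lemma nextPairWeight_le_one (hτ : ∀ z z', τ z z' ≤ 1) (hτ0 : ∀ z z', 0 ≤ τ z z')
    (hb : ∀ z z', τ z z' ≠ 0 → b z = b u ∧ b z' = b v) (x x' : Fin n) :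
    nextPairWeight b g K u v τ x x' ≤ 1 := by
  set f : ℕ → ℕ → Fin n → Fin n → ℝ := fun k k' z z' => τ z z' *
    pairSum b g (avoidedLabels b u v) k k' z z' (fun y y' => if y = x ∧ y' = x' then 1 else 0)
    with hf
  have hle : ∀ k k' z z', f k k' z z' ≤ 1 := by
    intro k k' z z'
    have h1 := pairSum_le_one (b := b) (g := g) (X := avoidedLabels b u v) k k' x x' z z'
    exact (mul_le_of_le_one_right (hτ0 z z') h1).trans (hτ z z')
  have huniq : ∀ k k' z z' l l' y y', f k k' z z' ≠ 0 → f l l' y y' ≠ 0 →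
      (k = l ∧ z = y) ∧ (k' = l' ∧ z' = y') := by
    intro k k' z z' l l' y y' h1 h2
    obtain ⟨hw1, hw1'⟩ := avoidingWalk_of_pairSum_ne_zero (right_ne_zero_of_mul h1)
    obtain ⟨hw2, hw2'⟩ := avoidingWalk_of_pairSum_ne_zero (right_ne_zero_of_mul h2)
    obtain ⟨hb1, hb1'⟩ := hb _ _ (left_ne_zero_of_mul h1)
    obtain ⟨hb2, hb2'⟩ := hb _ _ (left_ne_zero_of_mul h2)
    exact ⟨hw1.eq_of_mem hw2 (by simp [avoidedLabels, hb1]) (by simp [avoidedLabels, hb2]),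
      hw1'.eq_of_mem hw2' (by simp [avoidedLabels, hb1']) (by simp [avoidedLabels, hb2'])⟩
  change ∑ k ∈ Finset.range K, ∑ k' ∈ Finset.range K, ∑ z, ∑ z', f k k' z z' ≤ 1
  refine sum_le_one_of_unique_ne_zero (fun k _ => sum_le_one_of_unique_ne_zero (fun k' _ =>
    sum_le_one_of_unique_ne_zero (fun z _ => sum_le_one_of_unique_ne_zero
    (fun z' _ => hle k k' z z') ?_) ?_) ?_) ?_
  · exact fun z' _ y' _ h1 h2 => (huniq _ _ _ _ _ _ _ _ h1 h2).2.2
  · intro z _ y _ h1 h2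
    obtain ⟨z', -, h1⟩ := Finset.exists_ne_zero_of_sum_ne_zero h1
    obtain ⟨y', -, h2⟩ := Finset.exists_ne_zero_of_sum_ne_zero h2
    exact (huniq _ _ _ _ _ _ _ _ h1 h2).1.2
  · intro k' _ l' _ h1 h2
    obtain ⟨z, -, h1⟩ := Finset.exists_ne_zero_of_sum_ne_zero h1
    obtain ⟨y, -, h2⟩ := Finset.exists_ne_zero_of_sum_ne_zero h2
    obtain ⟨z', -, h1⟩ := Finset.exists_ne_zero_of_sum_ne_zero h1
    obtain ⟨y', -, h2⟩ := Finset.exists_ne_zero_of_sum_ne_zero h2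
    exact (huniq _ _ _ _ _ _ _ _ h1 h2).2.1
  · intro k _ l _ h1 h2
    obtain ⟨k', -, h1⟩ := Finset.exists_ne_zero_of_sum_ne_zero h1
    obtain ⟨l', -, h2⟩ := Finset.exists_ne_zero_of_sum_ne_zero h2
    obtain ⟨z, -, h1⟩ := Finset.exists_ne_zero_of_sum_ne_zero h1
    obtain ⟨y, -, h2⟩ := Finset.exists_ne_zero_of_sum_ne_zero h2
    obtain ⟨z', -, h1⟩ := Finset.exists_ne_zero_of_sum_ne_zero h1
    obtain ⟨y', -, h2⟩ := Finset.exists_ne_zero_of_sum_ne_zero h2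
    exact (huniq _ _ _ _ _ _ _ _ h1 h2).1.1

end Support

/-! ### Growth of the set of vertices leading to a target -/

section ReachSet

variable {n m : ℕ} {b : Fin n → Option (Fin m)} {g : Fin m → Fin (n + 1)} {R : Finset (Fin n)}

variable (b g R) in
/-- From `x` the walk is in `R` after `k` steps. -/
def ReachesIn : ℕ → Fin n → Prop
  | 0, x => x ∈ R
  | k + 1, x => ∃ y, StepTo b g x y ∧ ReachesIn k y

/-- A shortest walk into `R` never repeats a label, because vertices with equal labels have the same
successor and a repetition could be cut out. `hQ` is the invariant: a vertex with a used label is in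
`R` or still more than `k` steps away from it. -/
lemma exploreTo_of_reachesIn_minimal {k : ℕ} {x : Fin n} {Q : Finset (Option (Fin m))}
    (h : ReachesIn b g R k x) (hmin : ∀ i < k, ¬ ReachesIn b g R i x)
    (hQ : ∀ z, b z ∈ Q → z ∉ R → ∀ i ≤ k, ¬ ReachesIn b g R i z) (K : ℕ) :
    exploreTo b g (fun _ y => y ∈ R) True K Q x := by
  induction K generalizing k x Q with
  | zero => trivial
  | succ K ih =>
    cases k with
    | zero => exact Or.inl h
    | succ k =>
      have hxR : x ∉ R := hmin 0 (Nat.succ_pos k)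
      obtain ⟨y, ⟨j, hj, hg⟩, hy⟩ := id h
      refine Or.inr ⟨j, y, hj, ?_, hg, ?_⟩
      · intro hjQ
        exact hQ x (hj ▸ hjQ) hxR (k + 1) le_rfl h
      · refine ih hy (fun i hi hr => hmin (i + 1) (by omega) ⟨y, ⟨j, hj, hg⟩, hr⟩) ?_
        intro z hz hzR i hi hr
        rcases Finset.mem_insert.1 hz with hz | hz
        · cases i with
          | zero => exact hzR hr
          | succ i =>
            obtain ⟨y', hy', hr⟩ := hr
            obtain rfl := hy'.unique ⟨j, hz, hg⟩
            exact hmin (i + 1) (by omega) ⟨y', ⟨j, hj, hg⟩, hr⟩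
        · exact hQ z hz hzR i (by omega) hr

lemma exploreTo_of_reachesIn {k : ℕ} {x : Fin n} (h : ReachesIn b g R k x) (K : ℕ) :
    exploreTo b g (fun _ y => y ∈ R) True K ∅ x := by
  classical
  have hex : ∃ k, ReachesIn b g R k x := ⟨k, h⟩
  exact exploreTo_of_reachesIn_minimal (Nat.find_spec hex) (fun i hi => Nat.find_min hex hi)
    (by simp) K

variable (b g R) in
open Classical in
/-- The vertices from which the walk `z ↦ g (b z)` reaches `R`. -/
noncomputable def nextReachSet : Finset (Fin n) :=
  Finset.univ.filter fun x => ∃ k, ReachesIn b g R k x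

lemma mem_nextReachSet {x : Fin n} : x ∈ nextReachSet b g R ↔ ∃ k, ReachesIn b g R k x := by
  simp [nextReachSet]

lemma subset_nextReachSet : R ⊆ nextReachSet b g R := fun _ hx => mem_nextReachSet.2 ⟨0, hx⟩

open Classical in
-- Walks lasting `κ` steps are counted as successes; they add at most `2 / n`, which a nonempty `R`
-- absorbs into the factor.
lemma sum_card_nextReachSet_le {p : (Fin m → Fin (n + 1)) → ℝ} {κ : ℕ} (hn : 0 < n)
    (hp : IsFreshWeight p ∅ κ 1) (hκ : n ^ 2 ≤ 2 ^ (κ + 1)) (hR : R.Nonempty) :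
    ∑ g, p g * ((nextReachSet b g R).card : ℝ) ≤ (2 + 2 / n) * R.card := by
  have hn' : (0 : ℝ) < n := by exact_mod_cast hn
  have h1 : ∑ g, p g * ((nextReachSet b g R).card : ℝ) ≤
      ∑ y, ∑ g, (if exploreTo b g (fun _ y => y ∈ R) True κ ∅ y then p g else 0) := by
    rw [Finset.sum_comm]
    refine Finset.sum_le_sum fun g _ => ?_
    rw [nextReachSet, Finset.card_filter]
    push_cast
    rw [Finset.mul_sum]
    refine Finset.sum_le_sum fun y _ => ?_
    have h0 := hp.nonneg g
    by_cases hy : ∃ k, ReachesIn b g R k y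
    · obtain ⟨k, hk⟩ := id hy
      rw [if_pos hy, if_pos (exploreTo_of_reachesIn hk κ), mul_one]
    · rw [if_neg hy, mul_zero]
      split_ifs <;> simp [h0]
  refine h1.trans ((sum_explore_mem_le hn κ R hp).trans ?_)
  have hR1 : (1 : ℝ) ≤ R.card := by exact_mod_cast hR.card_pos
  have hpow : (n : ℝ) * (1 / 2) ^ κ ≤ 2 / n := by
    have h2 : (n : ℝ) ^ 2 ≤ 2 ^ (κ + 1) := by exact_mod_cast hκ
    rw [one_div, inv_pow, ← div_eq_mul_inv, div_le_div_iff₀ (by positivity) hn']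
    rw [sq, pow_succ] at h2
    linarith
  have : 0 ≤ 2 / (n : ℝ) := by positivity
  nlinarith

end ReachSet

/-! ### Iterating the levels, and their relation to reachability -/

section Levels

variable {n m t : ℕ}

lemma finalHash_eq_some {h : Fin t → Fin m → Fin (n + 1)} {j : Fin m} {q : Fin t} {v : Fin n}
    (h0 : ∀ i < q, h i j = 0) (hq : h q j = v.succ) : finalHash h j = some v := by
  have hex : ∃ q, h q j ≠ 0 := ⟨q, by rw [hq]; exact Fin.succ_ne_zero v⟩
  have hfind : Fin.find _ hex = q := by
    refine le_antisymm (Fin.find_le_of_pos hex (by rw [hq]; exact Fin.succ_ne_zero v)) ?_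
    by_contra hlt
    exact Fin.find_spec hex (h0 _ (not_le.1 hlt))
  rw [finalHash, dif_pos hex]
  simp [hfind, hq]

lemma exists_of_finalHash_eq_some {h : Fin t → Fin m → Fin (n + 1)} {j : Fin m} {v : Fin n}
    (hv : finalHash h j = some v) : ∃ q, (∀ i < q, h i j = 0) ∧ h q j = v.succ := by
  unfold finalHash at hv
  split_ifs at hv with hex
  refine ⟨Fin.find _ hex, fun i hi => ?_, ?_⟩
  · by_contra hne
    exact Fin.find_min hex hi hne
  · rw [← Option.some.inj hv, Fin.succ_pred]

/-- The label of `z` after the first `q` levels: the array value at the end of the walk from `z`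
that uses these levels only, and `none` if that walk runs into a cycle. -/
noncomputable def levelLabel (a : Fin n → Fin m) (h : Fin t → Fin m → Fin (n + 1)) :
    ℕ → Fin n → Option (Fin m)
  | 0 => fun z => some (a z)
  | q + 1 => if hq : q < t then nextLabel (levelLabel a h q) (h ⟨q, hq⟩) else levelLabel a h q

/-- The pair weights after `q` levels, starting with the single pair `(u, v)`. -/
noncomputable def levelPairWeight (a : Fin n → Fin m) (K : ℕ) (u v : Fin n)
    (h : Fin t → Fin m → Fin (n + 1)) : ℕ → Fin n → Fin n → ℝ
  | 0 => fun x x' => if x = u ∧ x' = v then 1 else 0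
  | q + 1 => if hq : q < t then
      nextPairWeight (levelLabel a h q) (h ⟨q, hq⟩) K u v (levelPairWeight a K u v h q)
      else levelPairWeight a K u v h q

/-- The vertices from which `u` is reached by the first `q` levels. -/
noncomputable def levelReachSet (a : Fin n → Fin m) (u : Fin n)
    (h : Fin t → Fin m → Fin (n + 1)) : ℕ → Finset (Fin n)
  | 0 => {u}
  | q + 1 => if hq : q < t then
      nextReachSet (levelLabel a h q) (h ⟨q, hq⟩) (levelReachSet a u h q)
      else levelReachSet a u h q

variable {a : Fin n → Fin m} {u v : Fin n} {K : ℕ}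

section Succ

variable {h : Fin t → Fin m → Fin (n + 1)} {q : ℕ}

lemma levelLabel_succ (hq : q < t) :
    levelLabel a h (q + 1) = nextLabel (levelLabel a h q) (h ⟨q, hq⟩) := by
  rw [levelLabel, dif_pos hq]

lemma levelPairWeight_succ (hq : q < t) :
    levelPairWeight a K u v h (q + 1) =
      nextPairWeight (levelLabel a h q) (h ⟨q, hq⟩) K u v (levelPairWeight a K u v h q) := by
  rw [levelPairWeight, dif_pos hq]

lemma levelReachSet_succ (hq : q < t) :
    levelReachSet a u h (q + 1) =
      nextReachSet (levelLabel a h q) (h ⟨q, hq⟩) (levelReachSet a u h q) := by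
  rw [levelReachSet, dif_pos hq]

end Succ

section Update

variable (h : Fin t → Fin m → Fin (n + 1)) (i : Fin t) (g : Fin m → Fin (n + 1))

/-- What the first `q` levels produce does not involve level `q`, so that level can be averaged with
the rest fixed. -/
lemma levelLabel_update {q : ℕ} (hq : q ≤ i) :
    levelLabel a (Function.update h i g) q = levelLabel a h q := by
  induction q with
  | zero => rfl
  | succ q ih =>
    have hqt : q < t := by omega
    rw [levelLabel_succ hqt, levelLabel_succ hqt, ih (by omega), Function.update_of_ne]
    exact fun hc => by rw [← hc] at hq; simp at hq

lemma levelPairWeight_update {q : ℕ} (hq : q ≤ i) :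
    levelPairWeight a K u v (Function.update h i g) q = levelPairWeight a K u v h q := by
  induction q with
  | zero => rfl
  | succ q ih =>
    have hqt : q < t := by omega
    rw [levelPairWeight_succ hqt, levelPairWeight_succ hqt, ih (by omega),
      levelLabel_update h i g (by omega), Function.update_of_ne]
    exact fun hc => by rw [← hc] at hq; simp at hq

lemma levelReachSet_update {q : ℕ} (hq : q ≤ i) :
    levelReachSet a u (Function.update h i g) q = levelReachSet a u h q := by
  induction q with
  | zero => rfl
  | succ q ih =>
    have hqt : q < t := by omega
    rw [levelReachSet_succ hqt, levelReachSet_succ hqt, ih (by omega),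
      levelLabel_update h i g (by omega), Function.update_of_ne]
    exact fun hc => by rw [← hc] at hq; simp at hq

end Update

section Soundness

variable {h : Fin t → Fin m → Fin (n + 1)} {q : ℕ}

/-- A label after `q` levels is the array value of a reachable vertex at which the first `q`
hash functions vanish. -/
lemma exists_of_levelLabel_eq_some (hq : q ≤ t) {z : Fin n} {j : Fin m}
    (hz : levelLabel a h q z = some j) :
    ∃ y ∈ outSet a (finalHash h) z, a y = j ∧ ∀ i : Fin t, i < q → h i j = 0 := by
  induction q generalizing z j with
  | zero =>
    exact ⟨z, Relation.ReflTransGen.refl, Option.some.inj hz, fun i hi => absurd hi (by simp)⟩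
  | succ q ih =>
    rw [levelLabel_succ (by omega), nextLabel_eq_some_iff] at hz
    induction hz with
    | halt h1 h2 =>
      obtain ⟨y, hy, hay, h0⟩ := ih (by omega) h1
      refine ⟨y, hy, hay, fun i hi => ?_⟩
      rcases Nat.lt_succ_iff_lt_or_eq.1 hi with hi | hi
      · exact h0 i hi
      · subst hi; exact h2
    | @step z v j j' h1 h2 _ ih' =>
      obtain ⟨y, hy, hay, h0⟩ := ih (by omega) h1
      obtain ⟨y', hy', hay', h0'⟩ := ih'
      refine ⟨y', ?_, hay', h0'⟩
      have hadj : (walkGraph a (finalHash h)).Adj y v := by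
        change finalHash h (a y) = some v
        rw [hay]
        exact finalHash_eq_some (fun i hi => h0 i hi) h2
      exact (Relation.ReflTransGen.tail hy hadj).trans hy'

/-- The label of `y` is the array value of a reachable vertex at which all earlier levels vanish, so
there the final hash reads level `q`. -/
lemma mem_outSet_of_stepTo (hq : q < t) {y z : Fin n}
    (hs : StepTo (levelLabel a h q) (h ⟨q, hq⟩) y z) : z ∈ outSet a (finalHash h) y := by
  obtain ⟨j, h1, h2⟩ := hs
  obtain ⟨x, hx, hax, h0⟩ := exists_of_levelLabel_eq_some hq.le h1
  refine Relation.ReflTransGen.tail hx ?_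
  change finalHash h (a x) = some _
  rw [hax]
  exact finalHash_eq_some (fun i hi => h0 i hi) h2

lemma mem_outSet_of_reflTransGen (hq : q < t) {y z : Fin n}
    (hs : Relation.ReflTransGen (StepTo (levelLabel a h q) (h ⟨q, hq⟩)) y z) :
    z ∈ outSet a (finalHash h) y := by
  induction hs with
  | refl => exact Relation.ReflTransGen.refl
  | tail _ h2 ih => exact Relation.ReflTransGen.trans ih (mem_outSet_of_stepTo hq h2)

lemma levelPairWeight_nonneg (q : ℕ) (x x' : Fin n) : 0 ≤ levelPairWeight a K u v h q x x' := by
  induction q generalizing x x' with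
  | zero => rw [levelPairWeight]; dsimp only; split_ifs <;> norm_num
  | succ q ih =>
    rw [levelPairWeight]
    split_ifs
    · exact nextPairWeight_nonneg _ _ _ _ _ ih _ _
    · exact ih _ _

/-- The equalities of labels are carried along because `nextPairWeight_le_one` needs them at the
next level. -/
lemma of_levelPairWeight_ne_zero (hq : q ≤ t) {x x' : Fin n}
    (hx : levelPairWeight a K u v h q x x' ≠ 0) :
    (u ∈ outSet a (finalHash h) x ∧ v ∈ outSet a (finalHash h) x') ∧
      levelLabel a h q x = levelLabel a h q u ∧ levelLabel a h q x' = levelLabel a h q v := by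
  induction q generalizing x x' with
  | zero =>
    obtain ⟨⟨rfl, rfl⟩, -⟩ := ite_ne_right_iff.1 hx
    exact ⟨⟨Relation.ReflTransGen.refl, Relation.ReflTransGen.refl⟩, rfl, rfl⟩
  | succ q ih =>
    rw [levelPairWeight_succ (by omega)] at hx
    obtain ⟨z, z', hz, h1, h2⟩ := exists_of_nextPairWeight_ne_zero hx
    obtain ⟨⟨h3, h4⟩, h5, h6⟩ := ih (by omega) hz
    refine ⟨⟨(mem_outSet_of_reflTransGen _ h1).trans h3,
      (mem_outSet_of_reflTransGen _ h2).trans h4⟩, ?_, ?_⟩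
    · rw [levelLabel_succ (by omega), reflTransGen_stepTo_nextLabel_eq h1, nextLabel_congr h5]
    · rw [levelLabel_succ (by omega), reflTransGen_stepTo_nextLabel_eq h2, nextLabel_congr h6]

lemma levelPairWeight_le_one (hq : q ≤ t) (x x' : Fin n) :
    levelPairWeight a K u v h q x x' ≤ 1 := by
  induction q generalizing x x' with
  | zero => rw [levelPairWeight]; dsimp only; split_ifs <;> norm_num
  | succ q ih =>
    rw [levelPairWeight_succ (by omega)]
    exact nextPairWeight_le_one (ih (by omega)) (levelPairWeight_nonneg q)
      (fun z z' hz => (of_levelPairWeight_ne_zero (by omega) hz).2) x x'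

end Soundness

section Completeness

variable {h : Fin t → Fin m → Fin (n + 1)} {q : ℕ}

lemma levelLabel_of_forall_eq_zero (hq : q ≤ t) {y : Fin n}
    (h0 : ∀ i : Fin t, i < q → h i (a y) = 0) : levelLabel a h q y = some (a y) := by
  induction q with
  | zero => rfl
  | succ q ih =>
    rw [levelLabel_succ (by omega)]
    exact nextLabel_of_zero (ih (by omega) fun i hi => h0 i (by omega)) (h0 ⟨q, by omega⟩ (by simp))

lemma levelLabel_eq_of_edge (hq : q ≤ t) {y y' : Fin n} {i : Fin t} (hi : i < q)
    (h0 : ∀ i' < i, h i' (a y) = 0) (hy : h i (a y) = y'.succ) :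
    levelLabel a h q y = levelLabel a h q y' := by
  induction q with
  | zero => simp at hi
  | succ q ih =>
    rw [levelLabel_succ (by omega)]
    rcases Nat.lt_succ_iff_lt_or_eq.1 hi with hi | rfl
    · exact nextLabel_congr (ih (by omega) hi)
    · exact nextLabel_of_succ (levelLabel_of_forall_eq_zero i.2.le fun i' hi' => h0 i' hi') hy

/-- The ends of an edge from an earlier level already share a label, hence take the same next step;
an edge of the current level is itself a step. -/
lemma mem_levelReachSet_of_edge (hq : q ≤ t) {y y' : Fin n} {i : Fin t} (hi : i < q)
    (h0 : ∀ i' < i, h i' (a y) = 0) (hy : h i (a y) = y'.succ)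
    (hr : y' ∈ levelReachSet a u h q) : y ∈ levelReachSet a u h q := by
  induction q with
  | zero => simp at hi
  | succ q ih =>
    rw [levelReachSet_succ (by omega), mem_nextReachSet] at hr ⊢
    obtain ⟨k, hk⟩ := hr
    rcases Nat.lt_succ_iff_lt_or_eq.1 hi with hi | rfl
    · cases k with
      | zero => exact ⟨0, ih (by omega) hi hk⟩
      | succ k =>
        obtain ⟨z, ⟨j, hj, hg⟩, hz⟩ := hk
        exact ⟨k + 1, z, ⟨j, (levelLabel_eq_of_edge (by omega) hi h0 hy).trans hj, hg⟩, hz⟩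
    · exact ⟨k + 1, y', ⟨a y, levelLabel_of_forall_eq_zero i.2.le fun i' hi' => h0 i' hi', hy⟩, hk⟩

lemma self_mem_levelReachSet (q : ℕ) : u ∈ levelReachSet a u h q := by
  induction q with
  | zero => simp [levelReachSet]
  | succ q ih =>
    rw [levelReachSet]
    split_ifs
    · exact subset_nextReachSet ih
    · exact ih

lemma mem_levelReachSet_of_mem_outSet {x : Fin n} (hx : u ∈ outSet a (finalHash h) x) :
    x ∈ levelReachSet a u h t := by
  refine Relation.ReflTransGen.head_induction_on hx (self_mem_levelReachSet t) ?_
  intro y y' hadj _ ih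
  obtain ⟨i, h0, hi⟩ := exists_of_finalHash_eq_some hadj
  exact mem_levelReachSet_of_edge le_rfl i.2 h0 hi ih

end Completeness

end Levels

/-! ### Expectations over all levels -/

section Expectation

variable {n m t : ℕ}

/-- Resampling one coordinate of a product weight does not change a sum. -/
lemma sum_prod_mul_eq_resample {ι G : Type*} [Fintype ι] [DecidableEq ι] [Fintype G]
    (p : ι → G → ℝ) (q : ι) (hp : ∑ g, p q g = 1) (f : (ι → G) → ℝ) :
    ∑ h : ι → G, (∏ i, p i (h i)) * f h =
      ∑ h : ι → G, (∏ i, p i (h i)) * ∑ g, p q g * f (Function.update h q g) := by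
  have hL : ∑ h : ι → G, (∏ i, p i (h i)) * f h =
      ∑ x : (ι → G) × G, (∏ i, p i (x.1 i)) * p q x.2 * f x.1 := by
    rw [Fintype.sum_prod_type]
    refine Finset.sum_congr rfl fun h _ => ?_
    dsimp only
    rw [← Finset.sum_mul, ← Finset.mul_sum, hp, mul_one]
  have hR : ∑ h : ι → G, (∏ i, p i (h i)) * ∑ g, p q g * f (Function.update h q g) =
      ∑ x : (ι → G) × G, (∏ i, p i (x.1 i)) * p q x.2 * f (Function.update x.1 q x.2) := by
    rw [Fintype.sum_prod_type]
    refine Finset.sum_congr rfl fun h _ => ?_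
    rw [Finset.mul_sum]
    exact Finset.sum_congr rfl fun g _ => by ring
  rw [hL, hR]
  -- Exchanging coordinate `q` with its independent copy preserves the product weight.
  let e : (ι → G) × G → (ι → G) × G := fun x => (Function.update x.1 q x.2, x.1 q)
  have he : Function.Involutive e := fun x => by simp [e]
  rw [← Equiv.sum_comp he.toPerm]
  refine Finset.sum_congr rfl fun x _ => ?_
  change (∏ i, p i (Function.update x.1 q x.2 i)) * p q (x.1 q) * f (Function.update x.1 q x.2) = _
  congr 1
  rw [← Finset.mul_prod_erase _ _ (Finset.mem_univ q),
    ← Finset.mul_prod_erase _ (fun i => p i (x.1 i)) (Finset.mem_univ q), Function.update_self,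
    Finset.prod_congr rfl fun i hi => by
      rw [Function.update_of_ne (Finset.ne_of_mem_erase hi)]]
  ring

open Classical in
lemma sampleLaw_real_eq (D : Fin t → Measure (Fin m → Fin (n + 1)))
    (hD : ∀ i, IsProbabilityMeasure (D i)) (P : (Fin t → Fin m → Fin (n + 1)) → Fin n → Prop) :
    (sampleLaw D).real {ω | P ω.1 ω.2} =
      ∑ h : Fin t → Fin m → Fin (n + 1), (∏ i, (D i).real {h i}) *
        (1 / n * ∑ x, if P h x then 1 else 0) := by
  rcases Nat.eq_zero_or_pos n with rfl | hn
  · have : {ω : (Fin t → Fin m → Fin (0 + 1)) × Fin 0 | P ω.1 ω.2} = ∅ := by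
      ext ω; exact ω.2.elim0
    rw [this]; simp
  have : Nonempty (Fin n) := ⟨⟨0, hn⟩⟩
  have : IsProbabilityMeasure (uniformOn (Set.univ : Set (Fin n))) :=
    isProbabilityMeasure_uniformOn Set.finite_univ Set.univ_nonempty
  have : IsProbabilityMeasure (sampleLaw D) := by unfold sampleLaw; infer_instance
  rw [measureReal_eq_sum_ite, Fintype.sum_prod_type]
  refine Finset.sum_congr rfl fun h _ => ?_
  simp only [Finset.mul_sum]
  refine Finset.sum_congr rfl fun x _ => ?_
  have hsing : (sampleLaw D).real {(h, x)} = (∏ i, (D i).real {h i}) * (1 / n) := by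
    rw [measureReal_def, sampleLaw, ← Set.singleton_prod_singleton, Measure.prod_prod,
      Measure.pi_singleton, ENNReal.toReal_mul, ENNReal.toReal_prod, uniformOn_univ]
    simp [measureReal_def]
  rw [hsing]
  split_ifs <;> simp

lemma IsFreshWeight.sum_prod_eq_one {κ : ℕ} {p : Fin t → (Fin m → Fin (n + 1)) → ℝ}
    (hp : ∀ i, IsFreshWeight (p i) ∅ κ 1) :
    ∑ h : Fin t → Fin m → Fin (n + 1), ∏ i, p i (h i) = 1 := by
  rw [← Fintype.prod_sum]
  exact Finset.prod_eq_one fun i _ => (hp i).sum_eq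

variable {a : Fin n → Fin m} {κ K : ℕ} {p : Fin t → (Fin m → Fin (n + 1)) → ℝ}

lemma sum_card_levelReachSet_le (hn : 0 < n) (hp : ∀ i, IsFreshWeight (p i) ∅ κ 1)
    (hκ : n ^ 2 ≤ 2 ^ (κ + 1)) (u : Fin n) {q : ℕ} (hq : q ≤ t) :
    ∑ h : Fin t → Fin m → Fin (n + 1), (∏ i, p i (h i)) * ((levelReachSet a u h q).card : ℝ) ≤
      (2 + 2 / n) ^ q := by
  induction q with
  | zero => simp [levelReachSet, IsFreshWeight.sum_prod_eq_one hp]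
  | succ q ih =>
    have hqt : q < t := by omega
    rw [sum_prod_mul_eq_resample p ⟨q, hqt⟩ (hp _).sum_eq, pow_succ, mul_comm (_ ^ q)]
    refine le_trans ?_ (mul_le_mul_of_nonneg_left (ih (by omega)) (by positivity))
    rw [Finset.mul_sum]
    refine Finset.sum_le_sum fun h _ => ?_
    rw [mul_left_comm]
    refine mul_le_mul_of_nonneg_left ?_ (Finset.prod_nonneg fun i _ => (hp i).nonneg _)
    have := sum_card_nextReachSet_le (b := levelLabel a h q) (R := levelReachSet a u h q) hn
      (hp ⟨q, hqt⟩) hκ ⟨u, self_mem_levelReachSet q⟩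
    refine le_trans (le_of_eq (Finset.sum_congr rfl fun g _ => ?_)) this
    rw [levelReachSet_succ hqt, levelLabel_update h ⟨q, hqt⟩ g le_rfl,
      levelReachSet_update h ⟨q, hqt⟩ g le_rfl, Function.update_self]

/-- Going back one level replaces `A` by `2 * A + 80`, so `q` levels give `2 ^ q * A + 80 * (2 ^ q -
1)`. -/
lemma pow_mul_potential_le (hn : 0 < n) (hK : n ≤ 2 ^ K)
    (hp : ∀ i, IsFreshWeight (p i) ∅ (4 * K) 1) (u v : Fin n) {q : ℕ} (hq : q ≤ t) {A : ℝ}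
    (hA : 0 ≤ A) :
    4 ^ q * max 0 (1 - (2 ^ q * A + 80 * (2 ^ q - 1)) *
        (√(collisionCount fun z => some (a z)) / n)) ≤
      ∑ h : Fin t → Fin m → Fin (n + 1), (∏ i, p i (h i)) *
        potential A (levelLabel a h q) u (levelPairWeight a K u v h q) := by
  induction q generalizing A with
  | zero =>
    have : ∀ h : Fin t → Fin m → Fin (n + 1),
        potential A (levelLabel a h 0) u (levelPairWeight a K u v h 0) =
        max 0 (1 - A * (√(collisionCount fun z => some (a z)) / n)) := by
      intro h
      simp [potential, levelLabel, levelPairWeight, ite_and]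
    simp only [this, ← Finset.sum_mul, IsFreshWeight.sum_prod_eq_one hp]
    simp
  | succ q ih =>
    have hqt : q < t := by omega
    have ih' := ih (by omega) (A := 2 * A + 80) (by positivity)
    rw [sum_prod_mul_eq_resample p ⟨q, hqt⟩ (hp _).sum_eq]
    have e : (2 : ℝ) ^ (q + 1) * A + 80 * (2 ^ (q + 1) - 1) =
        2 ^ q * (2 * A + 80) + 80 * (2 ^ q - 1) := by ring
    rw [e, pow_succ, mul_comm ((4 : ℝ) ^ q), mul_assoc]
    refine (mul_le_mul_of_nonneg_left ih' (by norm_num)).trans ?_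
    rw [Finset.mul_sum]
    refine Finset.sum_le_sum fun h _ => ?_
    rw [mul_left_comm]
    refine mul_le_mul_of_nonneg_left ?_ (Finset.prod_nonneg fun i _ => (hp i).nonneg _)
    refine (four_mul_potential_le hn hK (hp ⟨q, hqt⟩) u v (levelPairWeight_nonneg q) hA).trans
      (le_of_eq (Finset.sum_congr rfl fun g _ => ?_))
    rw [levelLabel_succ hqt, levelPairWeight_succ hqt, levelLabel_update h ⟨q, hqt⟩ g le_rfl,
      levelPairWeight_update h ⟨q, hqt⟩ g le_rfl, Function.update_self]

open Classical in
/-- After `q` levels, one more level links `u` to `v`. -/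
lemma sum_linked_le_card {h : Fin t → Fin m → Fin (n + 1)} {u v : Fin n} {q : ℕ} (hq : q < t) :
    ∑ x, ∑ x', levelPairWeight a K u v h q x x' *
      (if StepTo (levelLabel a h q) (h ⟨q, hq⟩) u x' then 1 else 0) ≤
    ∑ x, if u ∈ outSet a (finalHash h) x ∧ v ∈ outSet a (finalHash h) x then (1 : ℝ) else 0 := by
  refine Finset.sum_le_sum fun x _ => ?_
  by_cases hex : ∃ x', levelPairWeight a K u v h q x x' *
      (if StepTo (levelLabel a h q) (h ⟨q, hq⟩) u x' then 1 else 0) ≠ 0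
  · obtain ⟨x', hx'⟩ := hex
    have hτ := (of_levelPairWeight_ne_zero hq.le (left_ne_zero_of_mul hx')).1
    have hs := (ite_ne_right_iff.1 (right_ne_zero_of_mul hx')).1
    rw [if_pos ⟨hτ.1, hτ.1.trans ((mem_outSet_of_stepTo hq hs).trans hτ.2)⟩]
    -- The step from `u` has a single target, so each `x` counts at most once.
    refine sum_le_one_of_unique_ne_zero (fun y _ => ?_) (fun y _ y' _ hy hy' => ?_)
    · have h1 := levelPairWeight_le_one (K := K) (a := a) (u := u) (v := v) (h := h) hq.le x y
      split_ifs
      · rwa [mul_one]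
      · rw [mul_zero]; exact zero_le_one
    · exact (ite_ne_right_iff.1 (right_ne_zero_of_mul hy)).1.unique
        (ite_ne_right_iff.1 (right_ne_zero_of_mul hy')).1
  · push Not at hex
    rw [Finset.sum_eq_zero fun x' _ => hex x']
    split_ifs <;> norm_num

open Classical in
-- With `A = 0` the potential is the pair weight while `u` has a label. Then level `q`, independent
-- of these weights, sends `u` to each `x'` with probability `1 / (2 n)`.
theorem le_sum_card_linked (hn : 0 < n) (hK : n ≤ 2 ^ K) (hK1 : 1 ≤ K)
    (hp : ∀ i, IsFreshWeight (p i) ∅ (4 * K) 1) (u v : Fin n) {q : ℕ} (hq : q < t) :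
    4 ^ q * max 0 (1 - (80 * (2 ^ q - 1)) * (√(collisionCount fun z => some (a z)) / n)) *
        (1 / (2 * n)) ≤
      ∑ h : Fin t → Fin m → Fin (n + 1), (∏ i, p i (h i)) *
        ∑ x, if u ∈ outSet a (finalHash h) x ∧ v ∈ outSet a (finalHash h) x
          then (1 : ℝ) else 0 := by
  have h1 := pow_mul_potential_le (a := a) hn hK hp u v hq.le (le_refl (0 : ℝ))
  rw [mul_zero, zero_add] at h1
  refine (mul_le_mul_of_nonneg_right h1 (by positivity)).trans ?_
  refine le_trans ?_ (Finset.sum_le_sum fun h _ => mul_le_mul_of_nonneg_left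
    (sum_linked_le_card (K := K) hq) (Finset.prod_nonneg fun i _ => (hp i).nonneg _))
  rw [sum_prod_mul_eq_resample p ⟨q, hq⟩ (hp _).sum_eq (fun h => ∑ x, ∑ x',
    levelPairWeight a K u v h q x x' *
      (if StepTo (levelLabel a h q) (h ⟨q, hq⟩) u x' then 1 else 0)), Finset.sum_mul]
  refine Finset.sum_le_sum fun h _ => ?_
  rw [mul_assoc]
  refine mul_le_mul_of_nonneg_left ?_ (Finset.prod_nonneg fun i _ => (hp i).nonneg _)
  simp only [levelLabel_update h ⟨q, hq⟩ _ le_rfl, levelPairWeight_update h ⟨q, hq⟩ _ le_rfl,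
    Function.update_self, potential]
  by_cases hu : levelLabel a h q u = none
  · rw [if_pos hu, mul_zero, zero_mul]
    refine Finset.sum_nonneg fun g _ => mul_nonneg ((hp _).nonneg g) ?_
    refine Finset.sum_nonneg fun x _ => Finset.sum_nonneg fun x' _ =>
      mul_nonneg (levelPairWeight_nonneg _ _ _) ?_
    split_ifs <;> norm_num
  · obtain ⟨j, hj⟩ := Option.ne_none_iff_exists'.1 hu
    have hval : ∀ x', ∑ g, p ⟨q, hq⟩ g * (if StepTo (levelLabel a h q) g u x' then 1 else 0) =
        1 / (2 * n) := by
      intro x'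
      rw [← ((hp ⟨q, hq⟩).mono (Finset.Subset.refl _)
        (show 0 + 1 ≤ 4 * K by omega)).sum_value (Finset.notMem_empty (some j)) x']
      refine Finset.sum_congr rfl fun g _ => ?_
      have : StepTo (levelLabel a h q) g u x' ↔ g j = x'.succ := by simp [StepTo, hj]
      simp only [this, mul_ite, mul_one, mul_zero]
    have hswap : ∑ g, p ⟨q, hq⟩ g * ∑ x, ∑ x', levelPairWeight a K u v h q x x' *
        (if StepTo (levelLabel a h q) g u x' then 1 else 0) =
        ∑ x, ∑ x', levelPairWeight a K u v h q x x' *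
          ∑ g, p ⟨q, hq⟩ g * (if StepTo (levelLabel a h q) g u x' then 1 else 0) := by
      simp only [Finset.mul_sum]
      rw [Finset.sum_comm]
      refine Finset.sum_congr rfl fun x _ => ?_
      rw [Finset.sum_comm]
      refine Finset.sum_congr rfl fun x' _ => Finset.sum_congr rfl fun g _ => ?_
      ring
    rw [if_neg hu, zero_mul, sub_zero, max_eq_right zero_le_one, mul_one, hswap]
    simp only [hval, Finset.sum_mul, le_refl]

end Expectation

/-! ### Consequences of the rounded parameters -/

section Rounding

lemma IsRounding.floor_le {k : ℕ} {r : ℝ} (h : IsRounding k r) : ⌊r⌋₊ ≤ k := by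
  rcases h with rfl | rfl
  · exact le_rfl
  · exact Nat.floor_le_ceil r

/-- If `k` is at least `c log₂ n` rounded down, then `n ^ c < 2 ^ (k + 1)`. -/
lemma pow_lt_two_pow_of_floor_le {n k c : ℕ} (hn : 0 < n) (h : ⌊c * Real.logb 2 n⌋₊ ≤ k) :
    n ^ c < 2 ^ (k + 1) := by
  have h1 : c * Real.logb 2 n < (k + 1 : ℕ) :=
    (Nat.floor_lt' (Nat.succ_ne_zero k)).1 (Nat.lt_succ_of_le h)
  have h2 : Real.logb 2 ((n : ℝ) ^ c) < (k + 1 : ℕ) := by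
    rw [Real.logb_pow]; exact h1
  rw [Real.logb_lt_iff_lt_rpow (by norm_num) (by positivity), Real.rpow_natCast] at h2
  exact_mod_cast h2

lemma IsRounding.four_pow_lt {n t : ℕ} (hn : 0 < n)
    (h : IsRounding t (1 / 2 * Real.logb 2 n)) : n < 4 ^ (t + 1) := by
  have h1 : 1 / 2 * Real.logb 2 n < (t + 1 : ℕ) :=
    (Nat.floor_lt' (Nat.succ_ne_zero t)).1 (Nat.lt_succ_of_le h.floor_le)
  have h2 : Real.logb 2 n < (2 * (t + 1) : ℕ) := by push_cast at h1 ⊢; linarith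
  rw [Real.logb_lt_iff_lt_rpow (by norm_num) (by positivity), Real.rpow_natCast, pow_mul] at h2
  norm_num at h2
  exact_mod_cast h2

lemma ceil_half_logb_le {n : ℕ} (hn : 0 < n) : ⌈1 / 2 * Real.logb 2 n⌉₊ ≤ n := by
  rw [Nat.ceil_le]
  have h1 : Real.logb 2 n ≤ n := by
    rw [Real.logb_le_iff_le_rpow (by norm_num) (by positivity), Real.rpow_natCast]
    exact_mod_cast Nat.lt_two_pow_self.le
  have : (0 : ℝ) ≤ n := by positivity
  linarith

end Rounding

/-! ### The two probability bounds -/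

lemma collisionCount_some {n m : ℕ} (a : Fin n → Fin m) :
    collisionCount (fun z => some (a z)) = secondMoment a := by
  simp only [collisionCount, classCount, secondMoment, Option.some_inj]
  push_cast
  exact Finset.sum_congr rfl fun i _ => Finset.sum_congr rfl fun j _ => by simp [eq_comm]

theorem prob_mem_outSet_le {n m t κ : ℕ} (ht : t ≤ ⌈1 / 2 * Real.logb 2 n⌉₊)
    (hκ : IsRounding κ (20 * Real.logb 2 n)) {D : Fin t → Measure (Fin m → Fin (n + 1))}
    (hD : ∀ i, IsBuildingHash n m κ (D i)) (a : Fin n → Fin m) (u : Fin n) :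
    (sampleLaw D).real {ω | u ∈ outSet a (finalHash ω.1) ω.2} ≤ 3 * (2 ^ t / (n : ℝ)) := by
  classical
  have hn : 0 < n := u.pos
  have hn' : (0 : ℝ) < n := by exact_mod_cast hn
  have hκ' : n ^ 2 ≤ 2 ^ (κ + 1) :=
    (Nat.pow_le_pow_right hn (by norm_num)).trans
      (pow_lt_two_pow_of_floor_le (c := 20) hn (by exact_mod_cast hκ.floor_le)).le
  have hsum := sum_card_levelReachSet_le (a := a) hn (fun i => (hD i).isFreshWeight) hκ' u le_rfl
  rw [sampleLaw_real_eq D (fun i => (hD i).isProbabilityMeasure)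
    (fun h x => u ∈ outSet a (finalHash h) x)]
  have h1 : ∑ h : Fin t → Fin m → Fin (n + 1), (∏ i, (D i).real {h i}) *
      (1 / n * ∑ x, if u ∈ outSet a (finalHash h) x then (1 : ℝ) else 0) ≤
      1 / n * (2 + 2 / n) ^ t := by
    refine le_trans ?_ (mul_le_mul_of_nonneg_left hsum (by positivity))
    rw [Finset.mul_sum]
    refine Finset.sum_le_sum fun h _ => ?_
    rw [mul_left_comm]
    refine mul_le_mul_of_nonneg_left (mul_le_mul_of_nonneg_left ?_
      (Finset.prod_nonneg fun i _ => measureReal_nonneg)) (by positivity)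
    rw [Finset.sum_boole]
    exact_mod_cast Finset.card_le_card fun x hx =>
      mem_levelReachSet_of_mem_outSet (Finset.mem_filter.1 hx).2
  refine h1.trans ?_
  have htn : (t : ℝ) ≤ n := by exact_mod_cast ht.trans (ceil_half_logb_le hn)
  have h3 : (1 + 1 / (n : ℝ)) ^ t ≤ 3 := by
    have e1 : 1 + 1 / (n : ℝ) ≤ Real.exp (1 / n) := by
      rw [add_comm]; exact Real.add_one_le_exp _
    calc (1 + 1 / (n : ℝ)) ^ t ≤ Real.exp (1 / n) ^ t := by gcongr
      _ = Real.exp (t * (1 / n)) := (Real.exp_nat_mul _ _).symm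
      _ ≤ Real.exp 1 := by
        rw [Real.exp_le_exp, mul_one_div, div_le_one hn']; exact htn
      _ ≤ 3 := by have := Real.exp_one_lt_d9; linarith
  rw [show (2 : ℝ) + 2 / n = 2 * (1 + 1 / n) by ring, mul_pow]
  have h4 : (0 : ℝ) ≤ 2 ^ t / n := by positivity
  calc 1 / (n : ℝ) * (2 ^ t * (1 + 1 / n) ^ t) = (1 + 1 / n) ^ t * (2 ^ t / n) := by ring
    _ ≤ 3 * (2 ^ t / n) := mul_le_mul_of_nonneg_right h3 h4

theorem le_prob_mem_outSet {n m t κ : ℕ} (ht1 : 1 ≤ t)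
    (ht : IsRounding t (1 / 2 * Real.logb 2 n))
    (hκ : IsRounding κ (20 * Real.logb 2 n)) {D : Fin t → Measure (Fin m → Fin (n + 1))}
    (hD : ∀ i, IsBuildingHash n m κ (D i)) (a : Fin n → Fin m) {u v : Fin n} (huv : u ≠ v) :
    1 / 409600 / (secondMoment a : ℝ) ≤
      (sampleLaw D).real {ω | u ∈ outSet a (finalHash ω.1) ω.2 ∧
        v ∈ outSet a (finalHash ω.1) ω.2} := by
  classical
  have hn : 0 < n := u.pos
  have hn2 : 2 ≤ n := by
    by_contra hlt
    exact huv (Fin.ext (by omega))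
  have hn' : (0 : ℝ) < n := by exact_mod_cast hn
  -- The estimates need `4 * K ≤ κ` and `n ≤ 2 ^ K`; the constant `20` leaves room for both
  -- roundings, as `n ≥ 2`.
  set K := κ / 4 with hKdef
  have hκ' : n ^ 20 < 2 ^ (κ + 1) :=
    pow_lt_two_pow_of_floor_le (c := 20) hn (by exact_mod_cast hκ.floor_le)
  have hK : n ≤ 2 ^ K := by
    refine le_of_lt ((Nat.pow_lt_pow_iff_left (n := 4) (by norm_num)).1 ?_)
    have h1 : κ + 1 ≤ K * 4 + 4 := by omega
    have h2 : n ^ 4 * 2 ^ 16 ≤ n ^ 20 := by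
      calc n ^ 4 * 2 ^ 16 ≤ n ^ 4 * n ^ 16 :=
            Nat.mul_le_mul_left _ (Nat.pow_le_pow_left hn2 16)
        _ = n ^ 20 := by ring
    have h3 : 2 ^ (κ + 1) ≤ (2 ^ K) ^ 4 * 2 ^ 4 := by
      rw [← pow_mul, ← pow_add]
      exact Nat.pow_le_pow_right (by norm_num) h1
    omega
  have hK1 : 1 ≤ K := by
    by_contra hlt
    have : K = 0 := by omega
    rw [this] at hK
    omega
  set F : ℝ := (secondMoment a : ℝ) with hF
  have hFn : (n : ℝ) ≤ F := by
    rw [hF, ← collisionCount_some]; exact card_le_collisionCount _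
  have hF0 : 0 < F := lt_of_lt_of_le hn' hFn
  -- `r` is the least exponent with `n ^ 2 ≤ 320 ^ 2 * 4 ^ r * F`. If `r > 0`, minimality gives `320
  -- * 2 ^ (r - 1) * √F ≤ n`, which makes the loss at most `1 / 2`.
  obtain ⟨r, hrt, hr1, hr2⟩ : ∃ r, r < t ∧ 80 * (2 ^ r - 1) * (√F / n) ≤ 1 / 2 ∧
      (n : ℝ) ^ 2 ≤ 102400 * 4 ^ r * F := by
    have hex : ∃ r : ℕ, (n : ℝ) ^ 2 ≤ 102400 * 4 ^ r * F := by
      refine ⟨n, ?_⟩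
      have h1 : (n : ℝ) ≤ 4 ^ n := by exact_mod_cast (Nat.lt_pow_self (by norm_num)).le
      have : (n : ℝ) * n ≤ 4 ^ n * F := mul_le_mul h1 hFn hn'.le (by positivity)
      nlinarith
    refine ⟨Nat.find hex, ?_, ?_, Nat.find_spec hex⟩
    -- `t - 1` is admissible since `n ≤ 16 * 4 ^ (t - 1)` and `n ≤ F`; this keeps one level for the
    -- link from `u` towards `v`.
    · refine lt_of_le_of_lt (Nat.find_min' hex (m := t - 1) ?_) (by omega)
      have h1 : (n : ℝ) ≤ 4 ^ (t + 1) := by exact_mod_cast (ht.four_pow_lt hn).le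
      have h2 : (4 : ℝ) ^ (t + 1) = 16 * 4 ^ (t - 1) := by
        obtain ⟨s, rfl⟩ : ∃ s, t = s + 1 := ⟨t - 1, by omega⟩
        rw [Nat.add_sub_cancel]; ring
      rw [h2] at h1
      have : (n : ℝ) * n ≤ 16 * 4 ^ (t - 1) * F := mul_le_mul h1 hFn hn'.le (by positivity)
      nlinarith
    · rcases Nat.eq_zero_or_pos (Nat.find hex) with h0 | hpos
      · rw [h0]; norm_num
      · obtain ⟨s, hs⟩ : ∃ s, Nat.find hex = s + 1 := ⟨_, (Nat.succ_pred_eq_of_pos hpos).symm⟩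
        have hlt := Nat.find_min hex (m := s) (by omega)
        push Not at hlt
        rw [hs]
        have h1 : 320 * 2 ^ s * √F ≤ n := by
          refine le_of_sq_le_sq ?_ hn'.le
          rw [mul_pow, Real.sq_sqrt hF0.le, mul_pow, ← pow_mul, mul_comm s 2, pow_mul]
          norm_num
          linarith
        have h2 : 80 * (2 ^ (s + 1) - 1) * (√F / n) ≤ 160 * 2 ^ s * √F / n := by
          rw [← mul_div_assoc]
          refine div_le_div_of_nonneg_right ?_ hn'.le
          have := Real.sqrt_nonneg F
          rw [pow_succ]; linarith
        refine h2.trans ?_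
        rw [div_le_iff₀ hn']
        linarith
  have hlink := le_sum_card_linked (a := a) hn hK hK1
    (fun i => (hD i).isFreshWeight.mono (Finset.Subset.refl _) (show 4 * K ≤ κ by omega)) u v hrt
  rw [collisionCount_some] at hlink
  rw [sampleLaw_real_eq D (fun i => (hD i).isProbabilityMeasure)
    (fun h x => u ∈ outSet a (finalHash h) x ∧ v ∈ outSet a (finalHash h) x)]
  have hmax : 1 / 2 ≤ max 0 (1 - 80 * (2 ^ r - 1) * (√F / n)) :=
    le_trans (by linarith) (le_max_right _ _)
  have hlow : 4 ^ r * (1 / 2) * (1 / (2 * (n : ℝ))) ≤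
      ∑ h : Fin t → Fin m → Fin (n + 1), (∏ i, (D i).real {h i}) *
        ∑ x, if u ∈ outSet a (finalHash h) x ∧ v ∈ outSet a (finalHash h) x
          then (1 : ℝ) else 0 := by
    refine le_trans ?_ hlink
    gcongr
  have hscaled := mul_le_mul_of_nonneg_left hlow (show 0 ≤ 1 / (n : ℝ) by positivity)
  rw [Finset.mul_sum] at hscaled
  refine le_trans ?_ (hscaled.trans (le_of_eq (Finset.sum_congr rfl fun h _ =>
    by rw [mul_left_comm]; congr!)))
  -- `4 ^ r / (4 n ^ 2)` against `n ^ 2 ≤ 102400 * 4 ^ r * F` gives the constant `409600 = 4 *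
  -- 102400`.
  rw [div_div, show 1 / (n : ℝ) * (4 ^ r * (1 / 2) * (1 / (2 * n))) = 4 ^ r / (4 * n ^ 2) by
    field_simp; norm_num, div_le_div_iff₀ (by positivity) (by positivity)]
  linarith

theorem mainTheorem4 :
    (∃ c : ℝ, 0 < c ∧ ∀ (n m t κ : ℕ), 1 ≤ t →
      IsRounding t (1 / 2 * Real.logb 2 n) → IsRounding κ (20 * Real.logb 2 n) →
      ∀ D : Fin t → Measure (Fin m → Fin (n + 1)), (∀ i, IsBuildingHash n m κ (D i)) →
      ∀ (a : Fin n → Fin m) (u v : Fin n), u ≠ v →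
        c / (secondMoment a : ℝ) ≤
          (sampleLaw D).real {ω | u ∈ outSet a (finalHash ω.1) ω.2 ∧
            v ∈ outSet a (finalHash ω.1) ω.2}) ∧
    (∃ C : ℝ, 0 < C ∧ ∀ (n m t κ : ℕ),
      t ≤ ⌈1 / 2 * Real.logb 2 n⌉₊ → IsRounding κ (20 * Real.logb 2 n) →
      ∀ D : Fin t → Measure (Fin m → Fin (n + 1)), (∀ i, IsBuildingHash n m κ (D i)) →
      ∀ (a : Fin n → Fin m) (u : Fin n),
        (sampleLaw D).real {ω | u ∈ outSet a (finalHash ω.1) ω.2} ≤ C * (2 ^ t / (n : ℝ))) := by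
  refine ⟨⟨1 / 409600, by norm_num, ?_⟩, ⟨3, by norm_num, ?_⟩⟩
  · intro n m t κ ht1 ht hκ D hD a u v huv
    exact le_prob_mem_outSet ht1 ht hκ hD a huv
  · intro n m t κ ht hκ D hD a u
    exact prob_mem_outSet_le ht hκ hD a u
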